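/- All graphs are finite, simple and undirected, and connected graphs are non-empty. A path cover of a graph $G$ is a family $\mathcal{P}$ of subgraphs of $G$, each of them a path (a single vertex counts as a path), such that $\bigcup_{P\in\mathcal{P}}V(P)=V(G)$; it is a path partition if its members are moreover pairwise vertex-disjoint. Let $\mathrm{pc}(G)$ and $\mathrm{pp}(G)$ denote the minimum cardinality of a path cover and of a path partition of $G$, respectively. For a family $\mathcal{H}$ of graphs, $G$ is $\mathcal{H}$-free if no member of $\mathcal{H}$ is isomorphic to an induced subgraph of $G$. For two families $\mathcal{H}_1,\mathcal{H}_2$ of graphs, write $\mathcal{H}_1\le\mathcal{H}_2$ if for every $H_2\in\mathcal{H}_2$ there is $H_1\in\mathcal{H}_1$ isomorphic to an induced subgraph of $H_2$. Let $m,n\ge 1$ be integers. - $K_{1,n}$ is the star with $n$ leaves. - $K^*_m$ is the graph with vertices $x_i,y_i$ $(1\le i\le m)$ and edges $x_ix_j$ $(1\le i<j\le m)$ and $x_iy_i$ $(1\le i\le m)$. - $F^{(1)}_{m,n},\dots,F^{(4)}_{m,n}$ are graphs on the $m+n+2$ vertices $x_1,x_2,y_1,\dots,y_m,z_1,\dots,z_n$.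 The graph $F^{(1)}_{m,n}$ has the edges $x_1x_2,x_1y_1,x_1z_1$ together with $y_iy_{i+1}$ $(1\le i\le m-1)$ and $z_iz_{i+1}$ $(1\le i\le n-1)$; the graph $F^{(3)}_{m,n}$ has the edges $x_1y_1,x_1z_1,x_2y_1,x_2z_1$ together with $y_iy_{i+1}$ $(1\le i\le m-1)$ and $z_iz_{i+1}$ $(1\le i\le n-1)$. The graphs $F^{(2)}_{m,n}$ and $F^{(4)}_{m,n}$ are obtained from $F^{(1)}_{m,n}$ and $F^{(3)}_{m,n}$, respectively, by adding the edge $y_1z_1$. **Theorem.** Let $\mathcal{H}$ be a finite family of connected graphs. Then the following hold. (i) There is a constant $c_1=c_1(\mathcal{H})$ such that $\mathrm{pc}(G)\le c_1$ for every connected $\mathcal{H}$-free graph $G$ if and only if $\mathcal{H}\le\{K_{1,n},K^*_n,F^{(1)}_{n,n},F^{(2)}_{n,n}\}$ for some integer $n\ge 2$. (ii) There is a constant $c_2=c_2(\mathcal{H})$ such that $\mathrm{pp}(G)\le c_2$ for every connected $\mathcal{H}$-free graph $G$ if and only if $\mathcal{H}\le\{K_{1,n},K^*_n,F^{(1)}_{n,n},F^{(2)}_{n,n},F^{(3)}_{n,n},F^{(4)}_{n,n}\}$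 for some integer $n\ge 2$. -/

import Mathlib

/-! Path covers and path partitions of finite simple graphs, forbidden induced subgraphs. -/

universe u v

/-- A finite simple undirected graph, bundled with its vertex type. -/
structure FinGraph : Type (u + 1) where
  /-- The vertex type. -/
  V : Type u
  /-- The graph itself. -/
  graph : SimpleGraph V
  /-- There are finitely many vertices. -/
  finite : Finite V

attribute [instance] FinGraph.finite

/-- Bundle a simple graph on a finite vertex type. -/
def SimpleGraph.toFinGraph {V : Type u} [h : Finite V] (G : SimpleGraph V) : FinGraph.{u} :=
  ⟨V, G, h⟩

section PathNumbers

variable {V : Type u} {G : SimpleGraph V}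

/-- A subgraph is a path if it is isomorphic to the path `P_i` on `i` vertices for some `i ≥ 1`
(a single vertex is a path, the empty graph is not). -/
def SimpleGraph.Subgraph.IsPathSubgraph (P : G.Subgraph) : Prop :=
  ∃ i : ℕ, 1 ≤ i ∧ Nonempty (P.coe ≃g SimpleGraph.pathGraph i)

/-- A finite family of subgraphs of `G` is a path cover if all its members are paths and their
vertex sets cover the vertices of `G`. -/
def IsPathCover (G : SimpleGraph V) (𝓟 : Finset G.Subgraph) : Prop :=
  (∀ P ∈ 𝓟, P.IsPathSubgraph) ∧ ∀ x : V, ∃ P ∈ 𝓟, x ∈ P.verts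

/-- A path partition is a path cover whose members are pairwise vertex-disjoint. -/
def IsPathPartition (G : SimpleGraph V) (𝓟 : Finset G.Subgraph) : Prop :=
  IsPathCover G 𝓟 ∧ ∀ P ∈ 𝓟, ∀ Q ∈ 𝓟, P ≠ Q → Disjoint P.verts Q.verts

/-- The path cover number `pc(G)`: the minimum cardinality of a path cover of `G`. -/
noncomputable def pathCoverNumber (G : SimpleGraph V) : ℕ :=
  sInf {k : ℕ | ∃ 𝓟 : Finset G.Subgraph, IsPathCover G 𝓟 ∧ 𝓟.card = k}

/-- The path partition number `pp(G)`: the minimum cardinality of a path partition of `G`. -/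
noncomputable def pathPartitionNumber (G : SimpleGraph V) : ℕ :=
  sInf {k : ℕ | ∃ 𝓟 : Finset G.Subgraph, IsPathPartition G 𝓟 ∧ 𝓟.card = k}

/-- A finite graph is partitioned into its one-vertex paths, so both minima are attained. -/
theorem exists_isPathPartition [Finite V] (G : SimpleGraph V) :
    ∃ 𝓟 : Finset G.Subgraph, IsPathPartition G 𝓟 := by
  classical
  have := Fintype.ofFinite V
  refine ⟨Finset.univ.image fun x : V => G.singletonSubgraph x, ⟨?_, ?_⟩, ?_⟩
  · intro P hP
    obtain ⟨x, -, rfl⟩ := Finset.mem_image.1 hP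
    refine ⟨1, le_rfl, ⟨⟨⟨fun _ => 0, fun _ => ⟨x, by simp⟩, ?_, ?_⟩, ?_⟩⟩⟩
    · rintro ⟨y, hy⟩
      simp only [SimpleGraph.singletonSubgraph_verts, Set.mem_singleton_iff] at hy
      simp [hy]
    · intro i
      exact Subsingleton.elim _ _
    · intro a b
      simp
  · intro x
    exact ⟨G.singletonSubgraph x, Finset.mem_image_of_mem _ (Finset.mem_univ x), by simp⟩
  · intro P hP Q hQ hPQ
    obtain ⟨x, -, rfl⟩ := Finset.mem_image.1 hP
    obtain ⟨y, -, rfl⟩ := Finset.mem_image.1 hQ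
    simp only [SimpleGraph.singletonSubgraph_verts, Set.disjoint_singleton]
    rintro rfl
    exact hPQ rfl

end PathNumbers

section Families

/-- `G` is `ℋ`-free: no member of `ℋ` is isomorphic to an induced subgraph of `G`. -/
def IsFreeOf (ℋ : Set FinGraph.{u}) (G : FinGraph.{v}) : Prop :=
  ∀ H ∈ ℋ, ¬ H.graph.IsIndContained G.graph

/-- `ℋ₁ ≤ ℋ₂`: every member of `ℋ₂` has an induced subgraph isomorphic to a member of `ℋ₁`. -/
def FamilyLE (ℋ₁ : Set FinGraph.{u}) (ℋ₂ : Set FinGraph.{v}) : Prop :=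
  ∀ H₂ ∈ ℋ₂, ∃ H₁ ∈ ℋ₁, H₁.graph.IsIndContained H₂.graph

/-- The path cover numbers of the connected `ℋ`-free graphs are bounded by a constant. -/
def PathCoverBounded (ℋ : Set FinGraph.{u}) : Prop :=
  ∃ c : ℕ, ∀ G : FinGraph.{v}, G.graph.Connected → IsFreeOf ℋ G → pathCoverNumber G.graph ≤ c

/-- The path partition numbers of the connected `ℋ`-free graphs are bounded by a constant. -/
def PathPartitionBounded (ℋ : Set FinGraph.{u}) : Prop :=
  ∃ c : ℕ, ∀ G : FinGraph.{v}, G.graph.Connected → IsFreeOf ℋ G → pathPartitionNumber G.graph ≤ c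

end Families

section ForbiddenGraphs

open Sum

/-- The star `K_{1,n}`. -/
def starK (n : ℕ) : SimpleGraph (Fin 1 ⊕ Fin n) :=
  completeBipartiteGraph (Fin 1) (Fin n)

/-- The graph `K*_m`: a complete graph on `x_i = inl i` with a pendant vertex `y_i = inr i`
attached to each `x_i`. (`SimpleGraph.fromRel` symmetrizes a relation and discards loops.) -/
def kStar (m : ℕ) : SimpleGraph (Fin m ⊕ Fin m) :=
  SimpleGraph.fromRel fun a b => match a, b with
    | inl _, inl _ => True
    | inl i, inr j => i = j
    | _, _ => False

/-- The common vertex set of the graphs `F^{(i)}_{m,n}`: with indices shifted to start at `0`,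
`inl i` is `x_{i+1}`, `inr (inl i)` is `y_{i+1}`, and `inr (inr i)` is `z_{i+1}`. -/
abbrev FVertex (m n : ℕ) : Type := Fin 2 ⊕ (Fin m ⊕ Fin n)

/-- `F^{(1)}_{m,n}`: edges `x₁x₂`, `x₁y₁`, `x₁z₁`, `y_i y_{i+1}`, `z_i z_{i+1}`. -/
def graphF1 (m n : ℕ) : SimpleGraph (FVertex m n) :=
  SimpleGraph.fromRel fun a b => match a, b with
    | inl i, inl j => i = 0 ∧ j = 1
    | inl i, inr (inl j) => i = 0 ∧ j.val = 0
    | inl i, inr (inr j) => i = 0 ∧ j.val = 0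
    | inr (inl i), inr (inl j) => i.val + 1 = j.val
    | inr (inr i), inr (inr j) => i.val + 1 = j.val
    | _, _ => False

/-- `F^{(3)}_{m,n}`: edges `x₁y₁`, `x₁z₁`, `x₂y₁`, `x₂z₁`, `y_i y_{i+1}`, `z_i z_{i+1}`. -/
def graphF3 (m n : ℕ) : SimpleGraph (FVertex m n) :=
  SimpleGraph.fromRel fun a b => match a, b with
    | inl _, inr (inl j) => j.val = 0
    | inl _, inr (inr j) => j.val = 0
    | inr (inl i), inr (inl j) => i.val + 1 = j.val
    | inr (inr i), inr (inr j) => i.val + 1 = j.val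
    | _, _ => False

/-- The graph whose only edge is `y₁z₁`. -/
def edgeYZ (m n : ℕ) : SimpleGraph (FVertex m n) :=
  SimpleGraph.fromRel fun a b => match a, b with
    | inr (inl i), inr (inr j) => i.val = 0 ∧ j.val = 0
    | _, _ => False

/-- `F^{(2)}_{m,n}`: the graph `F^{(1)}_{m,n}` with the edge `y₁z₁` added. -/
def graphF2 (m n : ℕ) : SimpleGraph (FVertex m n) := graphF1 m n ⊔ edgeYZ m n

/-- `F^{(4)}_{m,n}`: the graph `F^{(3)}_{m,n}` with the edge `y₁z₁` added. -/
def graphF4 (m n : ℕ) : SimpleGraph (FVertex m n) := graphF3 m n ⊔ edgeYZ m n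

end ForbiddenGraphs

/-!
Both characterizations are proved by elementary extremal arguments.

*Necessity.* A vertex of degree one is an end of every path through it, so a graph with `k` such
vertices needs at least `k / 2` paths (`le_two_mul_pathCoverNumber`). If two vertices have the same
two neighbours and no others, then one of them is an end of its path in every path partition
(`le_two_mul_pathPartitionNumber`). Hence `K_{1,n}`, `K*_n` and the *combs* have large path numbers,
where a comb is a row of many copies of one `F^{(i)}`, consecutive copies overlapping in an arm. A
member of the finite family `ℋ` that is contained in a comb with long arms is connected and small,
so it sees at most one centre and is contained in `F^{(i)}` itself
(`isIndContained_fGraph_of_comb`).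

*Sufficiency.* A set of vertices with independence number `k` is the disjoint union of at most `k`
paths (`IndepBound.hasPartition`), so only parts with large independence number matter. In a graph
without `K_{1,n}` and `K*_n`, Ramsey's theorem shows that closed neighbourhoods preserve boundedness
of the independence number (`IndepBound.closedNbhd`). Let `z 0, …, z L` be a longest induced path.
If `L` is bounded, so is the radius of the graph, and we are done. Otherwise every vertex is close
to the path (`setDist_le_of_longest`), and a vertex that has a neighbour on the path and all of them
far from its ends has no neighbour at distance two from the path (`IsAttached.no_pendant`). So all
vertices except those of the inner part of the path and those attached to it are close to the end
segments of the path and have bounded independence number (`indepBound_compl_innerSet`).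

Finally let `A` be the set of attached vertices whose first neighbour is `z a`. Replacing a segment
of the path by an attached vertex produces other induced paths, and from them one sees that a vertex
of `A` is adjacent to `z (a + 1)` or to `z (a + 2)`; since `A` has bounded independence number,
boundedly many paths running along `z` cover everything (`hasCover_innerSet`). If `F^{(3)}` and
`F^{(4)}` are forbidden too, `A` is a clique all of whose vertices are adjacent to `z (a + 1)`, so
that a single path suffices (`hasPartition_innerSet`).
-/

/-! ### Ends of paths and lower bounds -/

section PathEnds

variable {V : Type u} {G : SimpleGraph V}

/-- The two vertices `e₀`, `e₁` are the ends of the path `P`: every other vertex of `P` has two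
neighbours in `P`. The last conjunct records that a path has no two vertices with two
common neighbours. -/
theorem SimpleGraph.Subgraph.IsPathSubgraph.exists_ends {P : G.Subgraph}
    (hP : P.IsPathSubgraph) :
    ∃ e : Bool → V,
      (∀ x ∈ P.verts, (∀ b, e b ≠ x) → ∃ y y', y ≠ y' ∧ P.Adj x y ∧ P.Adj x y') ∧
      ∀ x x' y y', P.Adj x y → P.Adj x y' → P.Adj x' y → P.Adj x' y' → x ≠ x' → y = y' := by
  obtain ⟨i, hi, ⟨φ⟩⟩ := hP
  refine ⟨fun b => (φ.symm (if b then ⟨0, by omega⟩ else ⟨i - 1, by omega⟩)).1, ?_, ?_⟩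
  · intro x hx hb
    set j := φ ⟨x, hx⟩ with hj
    have hjx : φ.symm j = ⟨x, hx⟩ := by simp [hj]
    have h0 : j.val ≠ 0 := by
      intro h
      apply hb true
      have : j = ⟨0, by omega⟩ := Fin.ext h
      simp [← this, hjx]
    have h1 : j.val ≠ i - 1 := by
      intro h
      apply hb false
      have : j = ⟨i - 1, by omega⟩ := Fin.ext h
      simp [← this, hjx]
    have hlt : j.val < i := j.2
    clear_value j
    refine ⟨(φ.symm ⟨j.val - 1, by omega⟩).1, (φ.symm ⟨j.val + 1, by omega⟩).1, ?_, ?_, ?_⟩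
    · intro h
      have h' := φ.symm.injective (Subtype.ext h)
      simp only [Fin.mk.injEq] at h'
      omega
    · have : P.coe.Adj (φ.symm j) (φ.symm ⟨j.val - 1, by omega⟩) := by
        rw [φ.symm.map_adj_iff, SimpleGraph.pathGraph_adj]
        simp only
        omega
      rw [hjx] at this
      exact this
    · have : P.coe.Adj (φ.symm j) (φ.symm ⟨j.val + 1, by omega⟩) := by
        rw [φ.symm.map_adj_iff, SimpleGraph.pathGraph_adj]
        exact Or.inl rfl
      rw [hjx] at this
      exact this
  · intro x x' y y' h1 h2 h3 h4 hne
    by_contra hne'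
    have key : ∀ a b (h : P.Adj a b), (φ ⟨a, P.edge_vert h⟩).val + 1 = (φ ⟨b, P.edge_vert h.symm⟩).val ∨
        (φ ⟨b, P.edge_vert h.symm⟩).val + 1 = (φ ⟨a, P.edge_vert h⟩).val := by
      intro a b h
      have : P.coe.Adj ⟨a, P.edge_vert h⟩ ⟨b, P.edge_vert h.symm⟩ := h
      rw [← φ.map_adj_iff, SimpleGraph.pathGraph_adj] at this
      exact this
    have k1 := key _ _ h1
    have k2 := key _ _ h2
    have k3 := key _ _ h3
    have k4 := key _ _ h4
    have n1 : (φ ⟨x, P.edge_vert h1⟩).val ≠ (φ ⟨x', P.edge_vert h3⟩).val := by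
      intro h
      exact hne (congrArg Subtype.val (φ.injective (Fin.ext h)))
    have n2 : (φ ⟨y, P.edge_vert h1.symm⟩).val ≠ (φ ⟨y', P.edge_vert h2.symm⟩).val := by
      intro h
      exact hne' (congrArg Subtype.val (φ.injective (Fin.ext h)))
    omega

/-- A path has only two ends, so `k` pairwise disjoint sets, each of which contains an end of a
member of `𝓟`, force `k ≤ 2 |𝓟|`. -/
theorem card_le_two_mul_of_ends {𝓟 : Finset G.Subgraph} (e : {P // P ∈ 𝓟} → Bool → V) {k : ℕ}
    (A : Fin k → Set V) (hA : ∀ g g' x, x ∈ A g → x ∈ A g' → g = g')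
    (h : ∀ g, ∃ P b, e P b ∈ A g) : k ≤ 2 * 𝓟.card := by
  choose P b hb using h
  have := Fintype.card_le_of_injective (fun g => (P g, b g)) (by
      intro g g' hg
      simp only [Prod.mk.injEq] at hg
      have h1 := hb g
      rw [hg.1, hg.2] at h1
      exact hA _ _ _ h1 (hb g'))
  simpa [mul_comm] using this

theorem exists_isPathCover_card_eq [Finite V] (G : SimpleGraph V) :
    ∃ 𝓟 : Finset G.Subgraph, IsPathCover G 𝓟 ∧ 𝓟.card = pathCoverNumber G := by
  obtain ⟨𝓟, h⟩ := exists_isPathPartition G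
  exact Nat.sInf_mem (s := {k : ℕ | ∃ 𝓟 : Finset G.Subgraph, IsPathCover G 𝓟 ∧ 𝓟.card = k})
    ⟨_, 𝓟, h.1, rfl⟩

theorem exists_isPathPartition_card_eq [Finite V] (G : SimpleGraph V) :
    ∃ 𝓟 : Finset G.Subgraph, IsPathPartition G 𝓟 ∧ 𝓟.card = pathPartitionNumber G := by
  obtain ⟨𝓟, h⟩ := exists_isPathPartition G
  exact Nat.sInf_mem (s := {k : ℕ | ∃ 𝓟 : Finset G.Subgraph, IsPathPartition G 𝓟 ∧ 𝓟.card = k})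
    ⟨_, 𝓟, h, rfl⟩

theorem pathCoverNumber_le_pathPartitionNumber [Finite V] (G : SimpleGraph V) :
    pathCoverNumber G ≤ pathPartitionNumber G := by
  obtain ⟨𝓟, h, h'⟩ := exists_isPathPartition_card_eq G
  exact Nat.sInf_le ⟨𝓟, h.1, h'⟩

theorem PathPartitionBounded.pathCoverBounded {ℋ : Set FinGraph.{u}}
    (h : PathPartitionBounded.{u, v} ℋ) : PathCoverBounded.{u, v} ℋ := by
  obtain ⟨c, hc⟩ := h
  exact ⟨c, fun G h1 h2 => (pathCoverNumber_le_pathPartitionNumber _).trans (hc G h1 h2)⟩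

/-- A vertex of degree at most one is an end of every path through it. -/
theorem le_two_mul_pathCoverNumber [Finite V] {k : ℕ} (l : Fin k → V) (hl : l.Injective)
    (hdeg : ∀ g y y', G.Adj (l g) y → G.Adj (l g) y' → y = y') :
    k ≤ 2 * pathCoverNumber G := by
  obtain ⟨𝓟, h, h'⟩ := exists_isPathCover_card_eq G
  rw [← h']
  choose e he _ using fun P : {P // P ∈ 𝓟} => (h.1 P.1 P.2).exists_ends
  refine card_le_two_mul_of_ends e (fun g => {l g}) ?_ ?_
  · rintro g g' x rfl hx
    exact hl hx
  · intro g
    obtain ⟨P, hP, hg⟩ := h.2 (l g)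
    by_contra! hne
    obtain ⟨y, y', hy, h1, h2⟩ := he ⟨P, hP⟩ (l g) hg (fun b => hne ⟨P, hP⟩ b)
    exact hy (hdeg g y y' h1.adj_sub h2.adj_sub)

/-- If two vertices have the same two neighbours, then one of them is an end of its path in any
path partition: otherwise both paths contain both neighbours, hence they coincide and contain a
cycle of length four. -/
theorem le_two_mul_pathPartitionNumber [Finite V] {k : ℕ} (l : Fin k × Bool → V)
    (hl : l.Injective) (m : Fin k × Bool → V)
    (hdeg : ∀ g b y, G.Adj (l (g, b)) y → ∃ b', y = m (g, b')) :
    k ≤ 2 * pathPartitionNumber G := by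
  obtain ⟨𝓟, h, h'⟩ := exists_isPathPartition_card_eq G
  rw [← h']
  choose e he he' using fun P : {P // P ∈ 𝓟} => (h.1.1 P.1 P.2).exists_ends
  refine card_le_two_mul_of_ends e (fun g => {l (g, true), l (g, false)}) ?_ ?_
  · rintro g g' x (rfl | rfl) (hx | hx) <;> simpa using congrArg Prod.fst (hl hx)
  · intro g
    by_contra! hne
    have key : ∀ b, ∃ P ∈ 𝓟, P.Adj (l (g, b)) (m (g, true)) ∧ P.Adj (l (g, b)) (m (g, false)) := by
      intro b
      obtain ⟨P, hP, hg⟩ := h.1.2 (l (g, b))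
      refine ⟨P, hP, ?_⟩
      obtain ⟨y, y', hy, h1, h2⟩ := he ⟨P, hP⟩ (l (g, b)) hg (by
        intro b' hb'
        have := hne ⟨P, hP⟩ b'
        rw [hb'] at this
        cases b <;> simp at this)
      obtain ⟨b1, rfl⟩ := hdeg g b y h1.adj_sub
      obtain ⟨b2, rfl⟩ := hdeg g b y' h2.adj_sub
      cases b1 <;> cases b2 <;>
        first | exact absurd rfl hy | exact ⟨h1, h2⟩ | exact ⟨h2, h1⟩
    obtain ⟨P, hP, h1, h2⟩ := key true
    obtain ⟨Q, hQ, h3, h4⟩ := key false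
    have hPQ : P = Q := by
      by_contra hPQ
      exact Set.disjoint_left.1 (h.2 P hP Q hQ hPQ) (P.edge_vert h1.symm) (Q.edge_vert h3.symm)
    subst hPQ
    have hmm := he' ⟨P, hP⟩ _ _ _ _ h1 h2 h3 h4 (fun h => by simpa using hl h)
    obtain ⟨y, y', hy, h5, h6⟩ := he ⟨P, hP⟩ (l (g, true)) (P.edge_vert h1) (by
        intro b' hb'
        have := hne ⟨P, hP⟩ b'
        rw [hb'] at this
        simp at this)
    obtain ⟨b1, rfl⟩ := hdeg g _ y h5.adj_sub
    obtain ⟨b2, rfl⟩ := hdeg g _ y' h6.adj_sub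
    cases b1 <;> cases b2 <;> first | exact hy rfl | exact hy hmm | exact hy hmm.symm

end PathEnds

/-! ### Large path numbers force members of the family -/

section Necessity

variable {W : Type}

/-- If path cover numbers of connected `ℋ`-free graphs are at most `c`, then a connected graph
with more than `2c` vertices of degree one has an induced subgraph in `ℋ`. -/
theorem exists_isIndContained_of_leaves {ℋ : Set FinGraph.{u}} {c : ℕ}
    (hc : ∀ G : FinGraph.{v}, G.graph.Connected → IsFreeOf ℋ G → pathCoverNumber G.graph ≤ c)
    [Finite W] (G : SimpleGraph W) (hG : G.Connected) {k : ℕ} (hk : 2 * c < k) (l : Fin k → W)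
    (hl : l.Injective) (hdeg : ∀ g y y', G.Adj (l g) y → G.Adj (l g) y' → y = y') :
    ∃ H ∈ ℋ, H.graph.IsIndContained G := by
  by_contra! hfree
  let φ : G.comap (Equiv.ulift.{v} : ULift.{v} W ≃ W) ≃g G := SimpleGraph.Iso.comap _ G
  have h1 := hc ⟨ULift.{v} W, G.comap (Equiv.ulift.{v} : ULift.{v} W ≃ W), inferInstance⟩
    (φ.connected_iff.2 hG) (fun H hH h => hfree H hH (h.trans ⟨φ.toEmbedding⟩))
  have h2 := le_two_mul_pathCoverNumber (G := G.comap (Equiv.ulift.{v} : ULift.{v} W ≃ W))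
    (fun g => ⟨l g⟩) (fun g g' h => hl (congrArg ULift.down h))
    (fun g y y' h h' => ULift.ext _ _ (hdeg g y.down y'.down h h'))
  dsimp only at h1
  omega

/-- If path partition numbers of connected `ℋ`-free graphs are at most `c`, then a connected graph
with more than `2c` pairs of twins of degree two has an induced subgraph in `ℋ`. -/
theorem exists_isIndContained_of_twins {ℋ : Set FinGraph.{u}} {c : ℕ}
    (hc : ∀ G : FinGraph.{v}, G.graph.Connected → IsFreeOf ℋ G → pathPartitionNumber G.graph ≤ c)
    [Finite W] (G : SimpleGraph W) (hG : G.Connected) {k : ℕ} (hk : 2 * c < k)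
    (l : Fin k × Bool → W) (hl : l.Injective) (m : Fin k × Bool → W)
    (hdeg : ∀ g b y, G.Adj (l (g, b)) y → ∃ b', y = m (g, b')) :
    ∃ H ∈ ℋ, H.graph.IsIndContained G := by
  by_contra! hfree
  let φ : G.comap (Equiv.ulift.{v} : ULift.{v} W ≃ W) ≃g G := SimpleGraph.Iso.comap _ G
  have h1 := hc ⟨ULift.{v} W, G.comap (Equiv.ulift.{v} : ULift.{v} W ≃ W), inferInstance⟩
    (φ.connected_iff.2 hG) (fun H hH h => hfree H hH (h.trans ⟨φ.toEmbedding⟩))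
  have h2 := le_two_mul_pathPartitionNumber (G := G.comap (Equiv.ulift.{v} : ULift.{v} W ≃ W))
    (fun p => ⟨l p⟩) (fun g g' h => hl (congrArg ULift.down h)) (fun p => ⟨m p⟩)
    (fun g b y h => by
      obtain ⟨b', hb'⟩ := hdeg g b y.down h
      exact ⟨b', ULift.ext _ _ hb'⟩)
  dsimp only at h1
  omega

theorem starK_connected (n : ℕ) : (starK n).Connected := by
  have : Nonempty (Fin 1 ⊕ Fin n) := ⟨Sum.inl 0⟩
  have h : ∀ x, (starK n).Reachable (Sum.inl 0) x := by
    rintro (x | x)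
    · rw [Subsingleton.elim x 0]
    · exact SimpleGraph.Adj.reachable (by simp [starK])
  exact ⟨fun x y => (h x).symm.trans (h y)⟩

theorem kStar_connected {n : ℕ} (hn : 0 < n) : (kStar n).Connected := by
  have : Nonempty (Fin n ⊕ Fin n) := ⟨Sum.inl ⟨0, hn⟩⟩
  have h' : ∀ x, (kStar n).Reachable (Sum.inl ⟨0, hn⟩) (Sum.inl x) := by
    intro x
    by_cases hx : (⟨0, hn⟩ : Fin n) = x
    · rw [hx]
    · exact SimpleGraph.Adj.reachable (by simp [kStar, hx])
  have h : ∀ x, (kStar n).Reachable (Sum.inl ⟨0, hn⟩) x := by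
    rintro (x | x)
    · exact h' x
    · exact (h' x).trans (SimpleGraph.Adj.reachable (by simp [kStar]))
  exact ⟨fun x y => (h x).symm.trans (h y)⟩

theorem eventually_starK {ℋ : Set FinGraph.{u}} (h : PathCoverBounded.{u, v} ℋ) :
    ∀ᶠ n in Filter.atTop, ∃ H ∈ ℋ, H.graph.IsIndContained (starK n) := by
  obtain ⟨c, hc⟩ := h
  filter_upwards [Filter.eventually_gt_atTop (2 * c)] with n hn
  refine exists_isIndContained_of_leaves hc _ (starK_connected n) hn Sum.inr Sum.inr_injective ?_
  rintro g (y | y) (y' | y') <;> simp [starK]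
  exact Subsingleton.elim y y'

theorem eventually_kStar {ℋ : Set FinGraph.{u}} (h : PathCoverBounded.{u, v} ℋ) :
    ∀ᶠ n in Filter.atTop, ∃ H ∈ ℋ, H.graph.IsIndContained (kStar n) := by
  obtain ⟨c, hc⟩ := h
  filter_upwards [Filter.eventually_gt_atTop (2 * c)] with n hn
  refine exists_isIndContained_of_leaves hc _ (kStar_connected (by omega)) hn Sum.inr
    Sum.inr_injective ?_
  rintro g (y | y) (y' | y') <;> simp [kStar]
  rintro rfl rfl
  rfl

end Necessity

/-! ### The four graphs as two arms and two extra vertices -/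

section FGraphs

open Sum

/-- The graphs `F^{(1)}`, `F^{(2)}`, `F^{(3)}`, `F^{(4)}` with arms of length `n`, indexed by two
bits: `e` says whether `y₁z₁` is an edge, and `q` whether `x₂` is a twin of `x₁` (rather than a
pendant vertex at `x₁`). -/
def fGraph (e q : Bool) (n : ℕ) : SimpleGraph (FVertex n n) :=
  match e, q with
  | false, false => graphF1 n n
  | true, false => graphF2 n n
  | false, true => graphF3 n n
  | true, true => graphF4 n n

/-- `x₁`, `x₂` and the arms `y`, `z` span an induced copy of `fGraph e q n` in `G`; only the first
`n` vertices of the arms matter. -/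
structure IsFCopy {V : Type u} (G : SimpleGraph V) (e q : Bool) (n : ℕ) (x₁ x₂ : V)
    (y z : ℕ → V) : Prop where
  y_inj : ∀ i < n, ∀ j < n, y i = y j → i = j
  y_adj : ∀ i < n, ∀ j < n, G.Adj (y i) (y j) ↔ i + 1 = j ∨ j + 1 = i
  z_inj : ∀ i < n, ∀ j < n, z i = z j → i = j
  z_adj : ∀ i < n, ∀ j < n, G.Adj (z i) (z j) ↔ i + 1 = j ∨ j + 1 = i
  yz_ne : ∀ i < n, ∀ j < n, y i ≠ z j
  yz_adj : ∀ i < n, ∀ j < n, G.Adj (y i) (z j) ↔ e = true ∧ i = 0 ∧ j = 0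
  x_ne : x₁ ≠ x₂
  x_adj : G.Adj x₁ x₂ ↔ q = false
  x₁y_ne : ∀ i < n, x₁ ≠ y i
  x₁y_adj : ∀ i < n, G.Adj x₁ (y i) ↔ i = 0
  x₁z_ne : ∀ i < n, x₁ ≠ z i
  x₁z_adj : ∀ i < n, G.Adj x₁ (z i) ↔ i = 0
  x₂y_ne : ∀ i < n, x₂ ≠ y i
  x₂y_adj : ∀ i < n, G.Adj x₂ (y i) ↔ q = true ∧ i = 0
  x₂z_ne : ∀ i < n, x₂ ≠ z i
  x₂z_adj : ∀ i < n, G.Adj x₂ (z i) ↔ q = true ∧ i = 0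

variable {n : ℕ}

theorem fGraph_adj_xx (e q : Bool) (a b : Fin 2) :
    (fGraph e q n).Adj (inl a) (inl b) ↔ q = false ∧ a ≠ b := by
  cases e <;> cases q <;> fin_cases a <;> fin_cases b <;>
    simp [fGraph, graphF1, graphF2, graphF3, graphF4, edgeYZ]

theorem fGraph_adj_xy (e q : Bool) (a : Fin 2) (i : Fin n) :
    (fGraph e q n).Adj (inl a) (inr (inl i)) ↔ (a = 0 ∨ q = true) ∧ i.val = 0 := by
  cases e <;> cases q <;> simp [fGraph, graphF1, graphF2, graphF3, graphF4, edgeYZ]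

theorem fGraph_adj_xz (e q : Bool) (a : Fin 2) (i : Fin n) :
    (fGraph e q n).Adj (inl a) (inr (inr i)) ↔ (a = 0 ∨ q = true) ∧ i.val = 0 := by
  cases e <;> cases q <;> simp [fGraph, graphF1, graphF2, graphF3, graphF4, edgeYZ]

theorem fGraph_adj_yz (e q : Bool) (i j : Fin n) :
    (fGraph e q n).Adj (inr (inl i)) (inr (inr j)) ↔ e = true ∧ i.val = 0 ∧ j.val = 0 := by
  cases e <;> cases q <;> simp [fGraph, graphF1, graphF2, graphF3, graphF4, edgeYZ]

theorem fGraph_adj_yy (e q : Bool) (i j : Fin n) :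
    (fGraph e q n).Adj (inr (inl i)) (inr (inl j)) ↔ i.val + 1 = j.val ∨ j.val + 1 = i.val := by
  have h : (i.val + 1 = j.val ∨ j.val + 1 = i.val) → i ≠ j := by rintro h rfl; omega
  cases e <;> cases q <;> simpa [fGraph, graphF1, graphF2, graphF3, graphF4, edgeYZ] using h

theorem fGraph_adj_zz (e q : Bool) (i j : Fin n) :
    (fGraph e q n).Adj (inr (inr i)) (inr (inr j)) ↔ i.val + 1 = j.val ∨ j.val + 1 = i.val := by
  have h : (i.val + 1 = j.val ∨ j.val + 1 = i.val) → i ≠ j := by rintro h rfl; omega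
  cases e <;> cases q <;> simpa [fGraph, graphF1, graphF2, graphF3, graphF4, edgeYZ] using h

/-- The map from the vertices of `fGraph e q n` given by two vertices and two arms. -/
def fMap {V : Type u} (x₁ x₂ : V) (y z : ℕ → V) : FVertex n n → V :=
  Sum.elim (fun a => if a = 0 then x₁ else x₂) (Sum.elim (fun i => y i) (fun i => z i))

theorem IsFCopy.exists_embedding {V : Type u} {G : SimpleGraph V} {e q : Bool} {x₁ x₂ : V}
    {y z : ℕ → V} (h : IsFCopy G e q n x₁ x₂ y z) :
    ∃ f : fGraph e q n ↪g G, ⇑f = fMap x₁ x₂ y z := by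
  have h2 : ∀ a : Fin 2, a = 0 ∨ a = 1 := by decide
  have hinj : Function.Injective (fMap (n := n) x₁ x₂ y z) := by
    rintro (a | i | i) (b | j | j) hij
    · rcases h2 a with rfl | rfl <;> rcases h2 b with rfl | rfl <;>
        first
          | rfl
          | exact absurd hij h.x_ne
          | exact absurd hij.symm h.x_ne
    · rcases h2 a with rfl | rfl
      · exact absurd hij (h.x₁y_ne j j.2)
      · exact absurd hij (h.x₂y_ne j j.2)
    · rcases h2 a with rfl | rfl
      · exact absurd hij (h.x₁z_ne j j.2)
      · exact absurd hij (h.x₂z_ne j j.2)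
    · rcases h2 b with rfl | rfl
      · exact absurd hij.symm (h.x₁y_ne i i.2)
      · exact absurd hij.symm (h.x₂y_ne i i.2)
    · rw [Fin.ext (h.y_inj i i.2 j j.2 hij)]
    · exact absurd hij (h.yz_ne i i.2 j j.2)
    · rcases h2 b with rfl | rfl
      · exact absurd hij.symm (h.x₁z_ne i i.2)
      · exact absurd hij.symm (h.x₂z_ne i i.2)
    · exact absurd hij.symm (h.yz_ne j j.2 i i.2)
    · rw [Fin.ext (h.z_inj i i.2 j j.2 hij)]
  have hxy : ∀ a (i : Fin n), G.Adj (fMap (n := n) x₁ x₂ y z (inl a)) (y i) ↔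
      (a = 0 ∨ q = true) ∧ i.val = 0 := by
    intro a i
    rcases h2 a with rfl | rfl
    · simpa [fMap] using h.x₁y_adj i i.2
    · simpa [fMap] using h.x₂y_adj i i.2
  have hxz : ∀ a (i : Fin n), G.Adj (fMap (n := n) x₁ x₂ y z (inl a)) (z i) ↔
      (a = 0 ∨ q = true) ∧ i.val = 0 := by
    intro a i
    rcases h2 a with rfl | rfl
    · simpa [fMap] using h.x₁z_adj i i.2
    · simpa [fMap] using h.x₂z_adj i i.2
  have hxx : ∀ a b, G.Adj (fMap (n := n) x₁ x₂ y z (inl a)) (fMap (n := n) x₁ x₂ y z (inl b)) ↔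
      q = false ∧ a ≠ b := by
    intro a b
    rcases h2 a with rfl | rfl <;> rcases h2 b with rfl | rfl
    · simp
    · simpa [fMap] using h.x_adj
    · simpa [fMap, G.adj_comm] using h.x_adj
    · simp
  refine ⟨⟨⟨fMap x₁ x₂ y z, hinj⟩, ?_⟩, rfl⟩
  rintro (a | i | i) (b | j | j)
  · exact (hxx a b).trans (fGraph_adj_xx e q a b).symm
  · exact (hxy a j).trans (fGraph_adj_xy e q a j).symm
  · exact (hxz a j).trans (fGraph_adj_xz e q a j).symm
  · rw [SimpleGraph.adj_comm (fGraph e q n), G.adj_comm]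
    exact (hxy b i).trans (fGraph_adj_xy e q b i).symm
  · exact (h.y_adj i i.2 j j.2).trans (fGraph_adj_yy e q i j).symm
  · exact (h.yz_adj i i.2 j j.2).trans (fGraph_adj_yz e q i j).symm
  · rw [SimpleGraph.adj_comm (fGraph e q n), G.adj_comm]
    exact (hxz b i).trans (fGraph_adj_xz e q b i).symm
  · rw [SimpleGraph.adj_comm (fGraph e q n), G.adj_comm]
    exact (h.yz_adj j j.2 i i.2).trans (fGraph_adj_yz e q j i).symm
  · exact (h.z_adj i i.2 j j.2).trans (fGraph_adj_zz e q i j).symm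

theorem IsFCopy.isIndContained {V : Type u} {G : SimpleGraph V} {e q : Bool} {x₁ x₂ : V}
    {y z : ℕ → V} (h : IsFCopy G e q n x₁ x₂ y z) : (fGraph e q n).IsIndContained G :=
  ⟨h.exists_embedding.choose⟩

end FGraphs

/-! ### Combs -/

section Comb

/-- The vertices of a comb: positions `0 < t < (k + 1) S` on a base line, each carrying the base
vertex `(t, false)`, and if `S ∣ t` also an extra vertex `(t, true)`. -/
abbrev CombVertex (S k : ℕ) : Type :=
  {p : ℕ × Bool // 0 < p.1 ∧ p.1 < (k + 1) * S ∧ (p.2 = true → S ∣ p.1)}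

/-- A comb is a row of `k` copies of `fGraph e q (S - 1)`, centred at the multiples of `S`, where
consecutive copies overlap in an arm. -/
def comb (e q : Bool) (S k : ℕ) : SimpleGraph (CombVertex S k) :=
  SimpleGraph.fromRel fun a b => match a.1, b.1 with
    | (t, false), (t', false) => t' = t + 1 ∨ (e = true ∧ t' = t + 2 ∧ S ∣ t + 1)
    | (t, true), (t', false) =>
      (q = false ∧ t = t') ∨ (q = true ∧ (t' + 1 = t ∨ t' = t + 1))
    | _, _ => False

variable {e q : Bool} {S k : ℕ}

instance : Finite (CombVertex S k) := by
  refine Finite.of_injective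
    (fun p : CombVertex S k => ((⟨p.1.1, p.2.2.1⟩, p.1.2) : Fin ((k + 1) * S) × Bool)) ?_
  rintro ⟨⟨a, b⟩, h⟩ ⟨⟨a', b'⟩, h'⟩ hab
  simp only [Prod.mk.injEq, Fin.mk.injEq] at hab
  exact Subtype.ext (Prod.ext hab.1 hab.2)

theorem comb_adj_ff {t t' : ℕ} {h h'} :
    (comb e q S k).Adj ⟨(t, false), h⟩ ⟨(t', false), h'⟩ ↔
      (t' = t + 1 ∨ t = t' + 1) ∨ (e = true ∧ ((t' = t + 2 ∧ S ∣ t + 1) ∨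
        (t = t' + 2 ∧ S ∣ t' + 1))) := by
  simp only [comb, SimpleGraph.fromRel_adj, ne_eq, Subtype.mk.injEq, Prod.mk.injEq, and_true]
  constructor
  · rintro ⟨-, h⟩; tauto
  · intro h
    refine ⟨by omega, by tauto⟩

theorem comb_adj_tf {t t' : ℕ} {h h'} :
    (comb e q S k).Adj ⟨(t, true), h⟩ ⟨(t', false), h'⟩ ↔
      (q = false ∧ t = t') ∨ (q = true ∧ (t' + 1 = t ∨ t' = t + 1)) := by
  simp [comb]

theorem comb_adj_tt {t t' : ℕ} {h h'} :
    ¬ (comb e q S k).Adj ⟨(t, true), h⟩ ⟨(t', true), h'⟩ := by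
  simp [comb]

theorem comb_connected (hS : 2 ≤ S) : (comb e q S k).Connected := by
  have hpos : 1 < (k + 1) * S := by nlinarith
  have hbase : ∀ t (h : 0 < t) (h' : t < (k + 1) * S),
      (comb e q S k).Reachable ⟨(1, false), by simpa using hpos⟩ ⟨(t, false), by simp [h, h']⟩ := by
    intro t
    induction t with
    | zero => intro h; omega
    | succ t ih =>
      intro h h'
      rcases Nat.eq_zero_or_pos t with rfl | ht
      · exact SimpleGraph.Reachable.refl _
      · exact (ih ht (by omega)).trans (SimpleGraph.Adj.reachable (comb_adj_ff.2 (by simp)))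
  have : Nonempty (CombVertex S k) := ⟨⟨(1, false), by simpa using hpos⟩⟩
  have h : ∀ x, (comb e q S k).Reachable ⟨(1, false), by simpa using hpos⟩ x := by
    rintro ⟨⟨t, b⟩, h, h', hd⟩
    dsimp only at h h' hd
    cases b
    · exact hbase t h h'
    · have hSt : S ≤ t := Nat.le_of_dvd h (hd rfl)
      cases q
      · exact (hbase t h h').trans (SimpleGraph.Adj.reachable (comb_adj_tf.2 (by simp)).symm)
      · exact (hbase (t - 1) (by omega) (by omega)).trans
          (SimpleGraph.Adj.reachable (comb_adj_tf.2 (by simp; omega)).symm)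
  exact ⟨fun x y => (h x).symm.trans (h y)⟩

/-- The vertex of a comb with prescribed coordinates; an arbitrary vertex if there is none. -/
noncomputable def combVertex [h : Nonempty (CombVertex S k)] (t : ℕ) (b : Bool) :
    CombVertex S k :=
  open Classical in
  if hp : 0 < t ∧ t < (k + 1) * S ∧ (b = true → S ∣ t) then ⟨(t, b), hp⟩ else h.some

theorem combVertex_eq [Nonempty (CombVertex S k)] {t : ℕ} {b : Bool}
    (hp : 0 < t ∧ t < (k + 1) * S ∧ (b = true → S ∣ t)) :
    combVertex t b = (⟨(t, b), hp⟩ : CombVertex S k) := dif_pos hp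

/-- The window of a comb around the multiple `c` of `S` is a copy of `fGraph e q (S - 1)`. -/
theorem comb_isFCopy [Nonempty (CombVertex S k)] {g : ℕ} (hS : 0 < S) (hg : g < k) :
    IsFCopy (comb e q S k) e q (S - 1) (combVertex ((g + 1) * S) false)
      (combVertex ((g + 1) * S) true) (fun i => combVertex ((g + 1) * S - 1 - i) false)
      (fun i => combVertex ((g + 1) * S + 1 + i) false) := by
  obtain ⟨c, hc⟩ : ∃ c, c = (g + 1) * S := ⟨_, rfl⟩
  have hSc : S ∣ c := hc ▸ dvd_mul_left _ _
  have hSle : S ≤ c := by rw [hc]; nlinarith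
  have hlt : c + S ≤ (k + 1) * S := by rw [hc]; nlinarith
  have hdvd : ∀ t, S ∣ t → c < t + S → t < c + S → t = c := by
    intro t ht h1 h2
    obtain ⟨a, rfl⟩ := ht
    obtain ⟨b, rfl⟩ := hSc
    have h3 : b < a + 1 := by
      by_contra! h
      have := Nat.mul_le_mul_left S h
      nlinarith
    have h4 : a < b + 1 := by
      by_contra! h
      have := Nat.mul_le_mul_left S h
      nlinarith
    rw [show a = b by omega]
  rw [← hc]
  have hx1 := combVertex_eq (S := S) (k := k) (t := c) (b := false) ⟨by omega, by omega, by simp⟩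
  have hx2 := combVertex_eq (S := S) (k := k) (t := c) (b := true) ⟨by omega, by omega, fun _ => hSc⟩
  have hy : ∀ i (hi : i < S - 1), (combVertex (c - 1 - i) false : CombVertex S k) = _ :=
    fun i hi => combVertex_eq (S := S) (k := k) (t := c - 1 - i) (b := false)
      ⟨by omega, by omega, by simp⟩
  have hz : ∀ i (hi : i < S - 1), (combVertex (c + 1 + i) false : CombVertex S k) = _ :=
    fun i hi => combVertex_eq (S := S) (k := k) (t := c + 1 + i) (b := false)
      ⟨by omega, by omega, by simp⟩
  constructor
  · intro i hi j hj h
    rw [hy i hi, hy j hj, Subtype.mk.injEq, Prod.mk.injEq] at h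
    omega
  · intro i hi j hj
    rw [hy i hi, hy j hj, comb_adj_ff]
    constructor
    · rintro (h | ⟨-, ⟨h, h'⟩ | ⟨h, h'⟩⟩)
      · omega
      · have := hdvd _ h' (by omega) (by omega); omega
      · have := hdvd _ h' (by omega) (by omega); omega
    · omega
  · intro i hi j hj h
    rw [hz i hi, hz j hj, Subtype.mk.injEq, Prod.mk.injEq] at h
    omega
  · intro i hi j hj
    rw [hz i hi, hz j hj, comb_adj_ff]
    constructor
    · rintro (h | ⟨-, ⟨h, h'⟩ | ⟨h, h'⟩⟩)
      · omega
      · have := hdvd _ h' (by omega) (by omega); omega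
      · have := hdvd _ h' (by omega) (by omega); omega
    · omega
  · intro i hi j hj h
    rw [hy i hi, hz j hj, Subtype.mk.injEq, Prod.mk.injEq] at h
    omega
  · intro i hi j hj
    rw [hy i hi, hz j hj, comb_adj_ff]
    constructor
    · rintro (h | ⟨he, ⟨h, h'⟩ | ⟨h, h'⟩⟩)
      · omega
      · exact ⟨he, by omega, by omega⟩
      · omega
    · rintro ⟨he, rfl, rfl⟩
      exact Or.inr ⟨he, Or.inl ⟨by omega, by rwa [show c - 1 - 0 + 1 = c by omega]⟩⟩
  · rw [hx1, hx2, Ne, Subtype.mk.injEq, Prod.mk.injEq]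
    simp
  · rw [hx1, hx2, (comb e q S k).adj_comm, comb_adj_tf]
    constructor
    · rintro (h | h)
      · exact h.1
      · omega
    · intro h
      exact Or.inl ⟨h, rfl⟩
  · intro i hi
    rw [hx1, hy i hi, Ne, Subtype.mk.injEq, Prod.mk.injEq]
    omega
  · intro i hi
    rw [hx1, hy i hi, comb_adj_ff]
    constructor
    · rintro (h | ⟨-, ⟨h, h'⟩ | ⟨h, h'⟩⟩)
      · omega
      · omega
      · have := hdvd _ h' (by omega) (by omega); omega
    · omega
  · intro i hi
    rw [hx1, hz i hi, Ne, Subtype.mk.injEq, Prod.mk.injEq]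
    omega
  · intro i hi
    rw [hx1, hz i hi, comb_adj_ff]
    constructor
    · rintro (h | ⟨-, ⟨h, h'⟩ | ⟨h, h'⟩⟩)
      · omega
      · have := hdvd _ h' (by omega) (by omega); omega
      · omega
    · omega
  · intro i hi
    rw [hx2, hy i hi, Ne, Subtype.mk.injEq, Prod.mk.injEq]
    simp
  · intro i hi
    rw [hx2, hy i hi, comb_adj_tf]
    constructor
    · rintro (⟨h, h'⟩ | ⟨h, h'⟩)
      · omega
      · exact ⟨h, by omega⟩
    · rintro ⟨h, rfl⟩
      exact Or.inr ⟨h, by omega⟩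
  · intro i hi
    rw [hx2, hz i hi, Ne, Subtype.mk.injEq, Prod.mk.injEq]
    simp
  · intro i hi
    rw [hx2, hz i hi, comb_adj_tf]
    constructor
    · rintro (⟨h, h'⟩ | ⟨h, h'⟩)
      · omega
      · exact ⟨h, by omega⟩
    · rintro ⟨h, rfl⟩
      exact Or.inr ⟨h, by omega⟩

/-- Adjacent vertices of a comb have positions that differ by at most two. -/
theorem comb_pos_le {a b : CombVertex S k} (h : (comb e q S k).Adj a b) :
    a.1.1 ≤ b.1.1 + 2 := by
  obtain ⟨⟨t, x⟩, ht⟩ := a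
  obtain ⟨⟨t', x'⟩, ht'⟩ := b
  cases x <;> cases x'
  · rw [comb_adj_ff] at h; simp only; omega
  · rw [SimpleGraph.adj_comm, comb_adj_tf] at h; simp only; omega
  · rw [comb_adj_tf] at h; simp only; omega
  · exact absurd h comb_adj_tt

/-- In a comb whose centres are far apart, a small connected graph sees at most one centre. -/
theorem isIndContained_fGraph_of_comb {U : Type u} [Fintype U] {H : SimpleGraph U}
    (hH : H.Connected) (hS : 2 * Fintype.card U < S) (hk : 0 < k)
    (h : H.IsIndContained (comb e q S k)) : H.IsIndContained (fGraph e q (S - 1)) := by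
  obtain ⟨f⟩ := h
  obtain ⟨a₀⟩ := hH.nonempty
  have : Nonempty (CombVertex S k) := ⟨f a₀⟩
  have hcard : 0 < Fintype.card U := Fintype.card_pos_iff.2 ⟨a₀⟩
  have hwalk : ∀ {a b : U} (p : H.Walk a b), (f a).1.1 ≤ (f b).1.1 + 2 * p.length := by
    intro a b p
    induction p with
    | nil => simp
    | cons hadj p ih =>
      have := comb_pos_le (f.map_adj_iff.2 hadj)
      rw [SimpleGraph.Walk.length_cons]
      omega
  have hdist : ∀ a b : U, (f a).1.1 < (f b).1.1 + S := by
    intro a b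
    obtain ⟨p, hp⟩ := (hH.preconnected a b).exists_isPath
    have := hwalk p
    have := hp.length_lt
    omega
  -- the largest position of a vertex of `H`
  obtain ⟨m, -, hm⟩ := Finset.exists_max_image Finset.univ (fun a => (f a).1.1) ⟨a₀, Finset.mem_univ _⟩
  have hcentre : ∃ g < k, ∀ a, (g + 1) * S < (f a).1.1 + S ∧ (f a).1.1 < (g + 1) * S + S := by
    have hmlt := (f m).2.2.1
    have hdiv := Nat.div_add_mod (f m).1.1 S
    have hmod := Nat.mod_lt (f m).1.1 (show 0 < S by omega)
    have hdlt : (f m).1.1 / S < k + 1 := Nat.div_lt_of_lt_mul (hmlt.trans_eq (mul_comm _ _))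
    rcases Nat.eq_zero_or_pos ((f m).1.1 / S) with h0 | hpos
    · refine ⟨0, hk, fun a => ?_⟩
      have h1 : (f a).1.1 ≤ (f m).1.1 := hm a (Finset.mem_univ _)
      have h2 := (f a).2.1
      rw [h0] at hdiv
      omega
    · refine ⟨(f m).1.1 / S - 1, by omega, fun a => ?_⟩
      rw [Nat.sub_add_cancel hpos, mul_comm]
      have h1 : (f a).1.1 ≤ (f m).1.1 := hm a (Finset.mem_univ _)
      have h2 := hdist m a
      omega
  obtain ⟨g, hg, hga⟩ := hcentre
  obtain ⟨ρ, hρ⟩ := (comb_isFCopy (e := e) (q := q) (show 0 < S by omega) hg).exists_embedding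
  have hrange : ∀ a, ∃ w, ρ w = f a := by
    intro a
    obtain ⟨h1, h2⟩ := hga a
    have hle : S ≤ (g + 1) * S := by nlinarith
    have hlt : (g + 1) * S + S ≤ (k + 1) * S := by nlinarith
    obtain ⟨⟨⟨t, b⟩, ht⟩, hfa⟩ : ∃ x, x = f a := ⟨_, rfl⟩
    rw [← hfa] at h1 h2 ⊢
    simp only at h1 h2
    obtain ⟨c, hc⟩ : ∃ c, c = (g + 1) * S := ⟨_, rfl⟩
    have hSc : S ∣ c := hc ▸ dvd_mul_left _ _
    rw [hρ]
    rw [← hc] at h1 h2 hle hlt ⊢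
    rcases lt_trichotomy t c with h | h | h
    · cases b
      · refine ⟨Sum.inr (Sum.inl ⟨c - 1 - t, by omega⟩), ?_⟩
        simp only [fMap, Sum.elim_inr, Sum.elim_inl]
        rw [show c - 1 - (c - 1 - t) = t by omega]
        exact combVertex_eq ht
      · exfalso
        have hd : S ∣ c - t := Nat.dvd_sub hSc (ht.2.2 rfl)
        have := Nat.le_of_dvd (by omega) hd
        omega
    · rw [← h]
      cases b
      · exact ⟨Sum.inl 0, combVertex_eq ht⟩
      · exact ⟨Sum.inl 1, combVertex_eq ht⟩
    · cases b
      · refine ⟨Sum.inr (Sum.inr ⟨t - c - 1, by omega⟩), ?_⟩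
        simp only [fMap, Sum.elim_inr]
        rw [show c + 1 + (t - c - 1) = t by omega]
        exact combVertex_eq ht
      · exfalso
        have hd : S ∣ t - c := Nat.dvd_sub (ht.2.2 rfl) hSc
        have := Nat.le_of_dvd (by omega) hd
        omega
  choose ψ hψ using hrange
  refine ⟨⟨⟨ψ, fun a b hab => f.injective ?_⟩, fun {a b} => ?_⟩⟩
  · rw [← hψ a, ← hψ b, hab]
  · change (fGraph e q (S - 1)).Adj (ψ a) (ψ b) ↔ H.Adj a b
    rw [← ρ.map_adj_iff, hψ, hψ, f.map_adj_iff]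

theorem Set.Finite.exists_card_bound {ℋ : Set FinGraph.{u}} (hfin : ℋ.Finite) :
    ∃ N, ∀ H ∈ ℋ, Nat.card H.V ≤ N := by
  obtain ⟨N, hN⟩ := (hfin.image fun H => Nat.card H.V).bddAbove
  exact ⟨N, fun H hH => hN (Set.mem_image_of_mem _ hH)⟩

theorem eventually_fGraph_of_comb {ℋ : Set FinGraph.{u}} (hfin : ℋ.Finite)
    (hconn : ∀ H ∈ ℋ, H.graph.Connected) (hk : 0 < k)
    (h : ∀ S, 2 ≤ S → ∃ H ∈ ℋ, H.graph.IsIndContained (comb e q S k)) :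
    ∀ᶠ n in Filter.atTop, ∃ H ∈ ℋ, H.graph.IsIndContained (fGraph e q n) := by
  obtain ⟨N, hN⟩ := hfin.exists_card_bound
  filter_upwards [Filter.eventually_ge_atTop (2 * N + 1)] with n hn
  obtain ⟨H, hH, hHc⟩ := h (n + 1) (by omega)
  have := Fintype.ofFinite H.V
  have hcard := hN H hH
  rw [Nat.card_eq_fintype_card] at hcard
  exact ⟨H, hH, isIndContained_fGraph_of_comb (hconn H hH) (by omega) hk hHc⟩

/-- The extra vertices of a comb with `q = false` have degree one. -/
theorem eventually_fGraph_pendant {ℋ : Set FinGraph.{u}} (hfin : ℋ.Finite)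
    (hconn : ∀ H ∈ ℋ, H.graph.Connected) (h : PathCoverBounded.{u, v} ℋ) (e : Bool) :
    ∀ᶠ n in Filter.atTop, ∃ H ∈ ℋ, H.graph.IsIndContained (fGraph e false n) := by
  obtain ⟨c, hc⟩ := h
  refine eventually_fGraph_of_comb (k := 2 * c + 1) hfin hconn (by omega) fun S hS => ?_
  have hlt : ∀ g : Fin (2 * c + 1), 0 < (g.val + 1) * S ∧ (g.val + 1) * S < (2 * c + 1 + 1) * S :=
    fun g => ⟨by positivity, by have := g.2; nlinarith⟩
  refine exists_isIndContained_of_leaves hc _ (comb_connected hS)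
    (show 2 * c < 2 * c + 1 by omega)
    (fun g => ⟨((g + 1) * S, true), (hlt g).1, (hlt g).2, fun _ => dvd_mul_left _ _⟩) ?_ ?_
  · intro g g' hg
    simp only [Subtype.mk.injEq, Prod.mk.injEq, and_true] at hg
    exact Fin.ext (by have := Nat.eq_of_mul_eq_mul_right (by omega) hg; omega)
  · rintro g ⟨⟨t, b⟩, ht⟩ ⟨⟨t', b'⟩, ht'⟩ h1 h2
    cases b
    · cases b'
      · simp only [comb_adj_tf, true_and, reduceCtorEq, false_and, or_false] at h1 h2
        exact Subtype.ext (Prod.ext (h1.symm.trans h2) rfl)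
      · exact absurd h2 comb_adj_tt
    · exact absurd h1 comb_adj_tt

/-- In a comb with `q = true`, each extra vertex `(t, true)` and the base vertex `(t, false)` have
the same two neighbours. -/
theorem eventually_fGraph_twin {ℋ : Set FinGraph.{u}} (hfin : ℋ.Finite)
    (hconn : ∀ H ∈ ℋ, H.graph.Connected) (h : PathPartitionBounded.{u, v} ℋ) (e : Bool) :
    ∀ᶠ n in Filter.atTop, ∃ H ∈ ℋ, H.graph.IsIndContained (fGraph e true n) := by
  obtain ⟨c, hc⟩ := h
  refine eventually_fGraph_of_comb (k := 2 * c + 1) hfin hconn (by omega) fun S hS => ?_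
  have hlt : ∀ g : Fin (2 * c + 1), S ≤ (g.val + 1) * S ∧
      (g.val + 1) * S + S ≤ (2 * c + 1 + 1) * S :=
    fun g => ⟨by nlinarith [g.val.zero_le], by have := g.2; nlinarith⟩
  refine exists_isIndContained_of_twins hc _ (comb_connected hS)
    (show 2 * c < 2 * c + 1 by omega)
    (fun p => ⟨((p.1 + 1) * S, p.2), by have := hlt p.1; simp only; omega,
      by have := hlt p.1; simp only; omega, fun _ => dvd_mul_left _ _⟩) ?_
    (fun p => ⟨(if p.2 then (p.1 + 1) * S + 1 else (p.1 + 1) * S - 1, false),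
      by have := hlt p.1; simp only; split <;> omega,
      by have := hlt p.1; simp only; split <;> omega, by simp⟩) ?_
  · rintro ⟨g, b⟩ ⟨g', b'⟩ hg
    simp only [Subtype.mk.injEq, Prod.mk.injEq] at hg
    exact Prod.ext (Fin.ext (by have := Nat.eq_of_mul_eq_mul_right (by omega) hg.1; simp only; omega)) hg.2
  · rintro g b ⟨⟨t, b'⟩, ht⟩ h1
    dsimp only at h1 ⊢
    have hg := hlt g
    have hnd : ∀ t, (t = (g.val + 1) * S + 1 ∨ t + 1 = (g.val + 1) * S) → ¬ S ∣ t := by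
      rintro t h2 h3
      have h4 : S ∣ (g.val + 1) * S := dvd_mul_left _ _
      rcases h2 with h2 | h2
      · rw [h2, Nat.dvd_add_right h4] at h3
        have := Nat.le_of_dvd one_pos h3
        omega
      · rw [← h2, Nat.dvd_add_right h3] at h4
        have := Nat.le_of_dvd one_pos h4
        omega
    have key : b' = false ∧ (t = (g.val + 1) * S + 1 ∨ t + 1 = (g.val + 1) * S) := by
      cases b
      · cases b'
        · rw [comb_adj_ff] at h1
          refine ⟨rfl, ?_⟩
          rcases h1 with h1 | ⟨-, h1 | h1⟩
          · omega
          · exact absurd h1.2 (hnd _ (by omega))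
          · exact absurd h1.2 (hnd _ (by omega))
        · rw [SimpleGraph.adj_comm, comb_adj_tf] at h1
          exact absurd (ht.2.2 rfl) (hnd t (by simp at h1; omega))
      · cases b'
        · rw [comb_adj_tf] at h1
          simp only [true_and, reduceCtorEq, false_and, false_or] at h1
          exact ⟨rfl, by omega⟩
        · exact absurd h1 comb_adj_tt
    obtain ⟨rfl, h2 | h2⟩ := key
    · exact ⟨true, Subtype.ext (Prod.ext (by simpa using h2) rfl)⟩
    · exact ⟨false, Subtype.ext (Prod.ext (by simp; omega) rfl)⟩

end Comb

/-! ### Independence numbers of neighbourhoods -/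

section Independence

variable {V : Type u} {G : SimpleGraph V}

/-- Every independent set of vertices of `G` inside `S` has at most `k` elements. -/
def IndepBound (G : SimpleGraph V) (S : Set V) (k : ℕ) : Prop :=
  ∀ I : Finset V, ↑I ⊆ S → G.IsIndepSet ↑I → I.card ≤ k

theorem IndepBound.mono {S T : Set V} {k : ℕ} (h : IndepBound G S k) (hT : T ⊆ S) :
    IndepBound G T k := fun I hI => h I (hI.trans hT)

/-- Ramsey's theorem, with the bound `2 ^ (p + q)` for a clique of size `p` or an independent set
of size `q`. -/
theorem exists_clique_or_indep (G : SimpleGraph V) (N : ℕ) : ∀ p q, p + q = N → ∀ S : Finset V,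
    2 ^ N ≤ S.card → (∃ T ⊆ S, G.IsClique ↑T ∧ T.card = p) ∨
      ∃ T ⊆ S, G.IsIndepSet ↑T ∧ T.card = q := by
  classical
  induction N with
  | zero =>
    intro p q hpq S _
    exact Or.inl ⟨∅, by simp, by simp, by simp; omega⟩
  | succ N ih =>
    intro p q hpq S hS
    rcases p with _ | p
    · exact Or.inl ⟨∅, by simp, by simp, by simp⟩
    rcases q with _ | q
    · exact Or.inr ⟨∅, by simp, by simp, by simp⟩
    have hpos : 0 < S.card := lt_of_lt_of_le (by positivity) hS
    obtain ⟨x, hx⟩ := Finset.card_pos.1 hpos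
    have hcard := Finset.card_erase_of_mem hx
    have hsplit := Finset.card_filter_add_card_filter_not (s := S.erase x) (fun y => G.Adj x y)
    rw [pow_succ] at hS
    have hN : 0 < 2 ^ N := by positivity
    rcases le_or_gt (2 ^ N) ((S.erase x).filter (fun y => G.Adj x y)).card with h | h
    · rcases ih p (q + 1) (by omega) _ h with ⟨T, hT, hc, hp⟩ | ⟨T, hT, hc, hp⟩
      · left
        have hTx : ∀ y ∈ T, y ∈ S ∧ G.Adj x y := fun y hy => by
          have := hT hy
          simp only [Finset.mem_filter, Finset.mem_erase] at this
          exact ⟨this.1.2, this.2⟩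
        have hxT : x ∉ T := fun h => G.irrefl (hTx x h).2
        refine ⟨insert x T, ?_, ?_, ?_⟩
        · intro y hy
          rcases Finset.mem_insert.1 hy with rfl | hy
          · exact hx
          · exact (hTx y hy).1
        · rw [Finset.coe_insert, SimpleGraph.isClique_insert]
          exact ⟨hc, fun y hy _ => (hTx y hy).2⟩
        · rw [Finset.card_insert_of_notMem hxT, hp]
      · exact Or.inr ⟨T, hT.trans ((Finset.filter_subset _ _).trans (Finset.erase_subset _ _)), hc, hp⟩
    · have h' : 2 ^ N ≤ ((S.erase x).filter (fun y => ¬ G.Adj x y)).card := by omega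
      rcases ih (p + 1) q (by omega) _ h' with ⟨T, hT, hc, hp⟩ | ⟨T, hT, hc, hp⟩
      · exact Or.inl ⟨T, hT.trans ((Finset.filter_subset _ _).trans (Finset.erase_subset _ _)), hc, hp⟩
      · right
        have hTx : ∀ y ∈ T, y ∈ S ∧ y ≠ x ∧ ¬ G.Adj x y := fun y hy => by
          have := hT hy
          simp only [Finset.mem_filter, Finset.mem_erase] at this
          exact ⟨this.1.2, this.1.1, this.2⟩
        have hxT : x ∉ T := fun h => (hTx x h).2.1 rfl
        refine ⟨insert x T, ?_, ?_, ?_⟩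
        · intro y hy
          rcases Finset.mem_insert.1 hy with rfl | hy
          · exact hx
          · exact (hTx y hy).1
        · rw [Finset.coe_insert, SimpleGraph.isIndepSet_iff, Set.pairwise_insert]
          exact ⟨hc, fun y hy _ => ⟨(hTx y hy).2.2, fun h => (hTx y hy).2.2 h.symm⟩⟩
        · rw [Finset.card_insert_of_notMem hxT, hp]

/-- In a `K_{1,n}`-free graph, every neighbourhood has independence number less than `n`. -/
theorem indepBound_neighborSet {n : ℕ} (hstar : ¬ (starK (n + 1)).IsIndContained G) (x : V) :
    IndepBound G {y | G.Adj x y} n := by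
  intro I hI hind
  by_contra! hcard
  obtain ⟨J, hJI, hJ⟩ := Finset.exists_subset_card_eq (show n + 1 ≤ I.card by omega)
  let e := J.equivFinOfCardEq hJ
  have hadj : ∀ i, G.Adj x (e.symm i) := fun i => hI (hJI (e.symm i).2)
  refine hstar ⟨⟨⟨Sum.elim (fun _ => x) (fun i => (e.symm i : V)), ?_⟩, ?_⟩⟩
  · rintro (i | i) (j | j) h
    · rw [Subsingleton.elim i j]
    · exact absurd h (hadj j).ne
    · exact absurd h.symm (hadj i).ne
    · exact congrArg Sum.inr (e.symm.injective (Subtype.ext h))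
  · rintro (i | i) (j | j)
    · change G.Adj x x ↔ _
      simp [starK]
    · change G.Adj x (e.symm j) ↔ _
      simpa [starK] using hadj j
    · change G.Adj (e.symm i) x ↔ _
      simpa [starK] using (hadj i).symm
    · change G.Adj (e.symm i) (e.symm j) ↔ _
      simp only [starK, completeBipartiteGraph_adj,
        Sum.isLeft_inr, Sum.isRight_inr, Bool.false_eq_true, and_true, and_false, or_self, iff_false]
      intro h
      exact hind (hJI (e.symm i).2) (hJI (e.symm j).2) h.ne h

/-- The vertices of `S` together with their neighbours. -/
def closedNbhd (G : SimpleGraph V) (S : Set V) : Set V := S ∪ {y | ∃ x ∈ S, G.Adj x y}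

/-- The bound for the independence number of the closed neighbourhood of a set with
independence number at most `a`. -/
def nbhdBound (n a : ℕ) : ℕ := a + 2 ^ (n + 1 + (a + 1)) * n

/-- In a graph without induced `K_{1,n}` and `K*_n`, closed neighbourhoods of sets of bounded
independence number have bounded independence number. Given an independent set `I` of neighbours of
`S`, a minimal subset `D` of `S` dominating `I` provides private neighbours; hence a large clique in
`D` yields `K*_n`, and Ramsey's theorem bounds `D`. -/
theorem IndepBound.closedNbhd {n a : ℕ} (hstar : ¬ (starK (n + 1)).IsIndContained G)
    (hkstar : ¬ (kStar (n + 1)).IsIndContained G) {S : Set V} (hS : IndepBound G S a) :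
    IndepBound G (closedNbhd G S) (nbhdBound n a) := by
  classical
  intro I hI hind
  have h1 : (I.filter (· ∈ S)).card ≤ a :=
    hS _ (fun x hx => (Finset.mem_filter.1 hx).2)
      (hind.mono (fun x hx => (Finset.mem_filter.1 hx).1))
  set J := I.filter (· ∉ S) with hJ
  have hcard : (I.filter (· ∈ S)).card + J.card = I.card :=
    Finset.card_filter_add_card_filter_not _
  have hJind : G.IsIndepSet ↑J := hind.mono (fun x hx => (Finset.mem_filter.1 hx).1)
  have hdom : ∀ y ∈ J, ∃ x ∈ S, G.Adj x y := fun y hy => by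
    obtain ⟨hy1, hy2⟩ := Finset.mem_filter.1 hy
    exact (hI hy1).resolve_left hy2
  choose! φ hφS hφ using hdom
  have hex : ∃ D : Finset V, ↑D ⊆ S ∧ ∀ y ∈ J, ∃ x ∈ D, G.Adj x y :=
    ⟨J.image φ, by
      intro x hx
      obtain ⟨y, hy, rfl⟩ := Finset.mem_image.1 hx
      exact hφS y hy, fun y hy => ⟨φ y, Finset.mem_image_of_mem _ hy, hφ y hy⟩⟩
  obtain ⟨D, hD⟩ := exists_minimal_of_wellFoundedLT
    (fun D : Finset V => ↑D ⊆ S ∧ ∀ y ∈ J, ∃ x ∈ D, G.Adj x y) hex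
  obtain ⟨hDS, hDdom⟩ := hD.prop
  have hpriv : ∀ x ∈ D, ∃ y ∈ J, G.Adj x y ∧ ∀ x' ∈ D, G.Adj x' y → x' = x := by
    intro x hx
    by_contra! hno
    have hle := hD.le_of_le (y := D.erase x) ⟨fun z hz => hDS (Finset.mem_of_mem_erase hz), by
      intro y hy
      obtain ⟨x', hx', hadj⟩ := hDdom y hy
      by_cases hxx : x' = x
      · subst hxx
        obtain ⟨x'', hx'', hadj'', hne⟩ := hno y hy hadj
        exact ⟨x'', Finset.mem_erase.2 ⟨hne, hx''⟩, hadj''⟩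
      · exact ⟨x', Finset.mem_erase.2 ⟨hxx, hx'⟩, hadj⟩⟩ (Finset.erase_subset _ _)
    exact Finset.notMem_erase x D (hle hx)
  choose! y hyJ hy hyu using hpriv
  have hDcard : D.card ≤ 2 ^ (n + 1 + (a + 1)) := by
    by_contra! hlt
    rcases exists_clique_or_indep G _ (n + 1) (a + 1) rfl D hlt.le with
      ⟨T, hT, hc, hp⟩ | ⟨T, hT, hc, hp⟩
    · let e := T.equivFinOfCardEq hp
      have heD : ∀ i, (e.symm i : V) ∈ D := fun i => hT (e.symm i).2
      have heinj : ∀ i j, (e.symm i : V) = e.symm j → i = j :=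
        fun i j h => e.symm.injective (Subtype.ext h)
      have hxy : ∀ i j, G.Adj (e.symm i : V) (y (e.symm j)) ↔ i = j := fun i j =>
        ⟨fun h => heinj _ _ (hyu _ (heD j) _ (heD i) h), fun h => h ▸ hy _ (heD i)⟩
      have hyS : ∀ i, y (e.symm i) ∉ S := fun i => (Finset.mem_filter.1 (hyJ _ (heD i))).2
      have hxy_ne : ∀ i j, (e.symm i : V) ≠ y (e.symm j) :=
        fun i j h => hyS j (h ▸ hDS (heD i))
      refine hkstar ⟨⟨⟨Sum.elim (fun i => (e.symm i : V)) (fun i => y (e.symm i)), ?_⟩, ?_⟩⟩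
      · rintro (i | i) (j | j) h
        · exact congrArg Sum.inl (heinj _ _ h)
        · exact absurd h (hxy_ne i j)
        · exact absurd h.symm (hxy_ne j i)
        · have : i = j := (hxy i j).1 (by
            have h' : y (e.symm i : V) = y (e.symm j) := h
            rw [← h']; exact hy _ (heD i))
          rw [this]
      · rintro (i | i) (j | j)
        · change G.Adj (e.symm i) (e.symm j) ↔ _
          simp only [kStar, SimpleGraph.fromRel_adj, ne_eq, Sum.inl.injEq, or_self, and_true]
          exact ⟨fun h hij => h.ne (by rw [hij]), fun h => hc (e.symm i).2 (e.symm j).2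
            (fun h' => h (heinj _ _ h'))⟩
        · change G.Adj (e.symm i) (y (e.symm j)) ↔ _
          simpa [kStar] using hxy i j
        · change G.Adj (y (e.symm i)) (e.symm j) ↔ _
          rw [G.adj_comm]
          simpa [kStar] using hxy j i
        · change G.Adj (y (e.symm i)) (y (e.symm j)) ↔ _
          simp only [kStar, SimpleGraph.fromRel_adj, or_self, and_false, iff_false]
          intro h
          exact hJind (hyJ _ (heD i)) (hyJ _ (heD j)) h.ne h
    · have := hS T (fun z hz => hDS (hT hz)) hc
      omega
  have hJcard : J.card ≤ D.card * n := by
    calc J.card ≤ (D.biUnion fun x => J.filter (G.Adj x)).card := by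
          refine Finset.card_le_card fun z hz => ?_
          obtain ⟨x, hx, hadj⟩ := hDdom z hz
          exact Finset.mem_biUnion.2 ⟨x, hx, Finset.mem_filter.2 ⟨hz, hadj⟩⟩
      _ ≤ D.card * n := Finset.card_biUnion_le_card_mul _ _ _ fun x _ =>
          indepBound_neighborSet hstar x _ (fun z hz => (Finset.mem_filter.1 hz).2)
            (hJind.mono fun z hz => (Finset.mem_filter.1 hz).1)
  have := Nat.mul_le_mul_right n hDcard
  rw [nbhdBound]
  omega

end Independence

/-! ### Distance from a set -/

section Level

variable {V : Type u} {G : SimpleGraph V} {S : Set V}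

/-- The distance of a vertex from a set of vertices (zero if the set is empty). -/
noncomputable def setDist (G : SimpleGraph V) (S : Set V) (x : V) : ℕ := sInf ((G.dist x) '' S)

theorem exists_dist_eq_setDist (hS : S.Nonempty) (x : V) : ∃ s ∈ S, G.dist x s = setDist G S x :=
  Nat.sInf_mem (hS.image _)

theorem setDist_le {s : V} (hs : s ∈ S) (x : V) : setDist G S x ≤ G.dist x s :=
  Nat.sInf_le (Set.mem_image_of_mem _ hs)

theorem setDist_eq_zero (hG : G.Connected) (hS : S.Nonempty) {x : V} :
    setDist G S x = 0 ↔ x ∈ S := by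
  constructor
  · intro h
    obtain ⟨s, hs, hd⟩ := exists_dist_eq_setDist (G := G) hS x
    rw [h, hG.dist_eq_zero_iff] at hd
    exact hd ▸ hs
  · intro h
    simpa using setDist_le (G := G) h x

theorem setDist_le_of_adj (hG : G.Connected) (hS : S.Nonempty) {x y : V} (h : G.Adj x y) :
    setDist G S x ≤ setDist G S y + 1 := by
  obtain ⟨s, hs, hd⟩ := exists_dist_eq_setDist (G := G) hS y
  have h1 := setDist_le (G := G) hs x
  have h2 := hG.dist_triangle (u := x) (v := y) (w := s)
  rw [SimpleGraph.dist_eq_one_iff_adj.2 h] at h2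
  omega

theorem exists_adj_setDist (hG : G.Connected) (hS : S.Nonempty) {x : V} {k : ℕ}
    (h : setDist G S x = k + 1) : ∃ y, G.Adj x y ∧ setDist G S y = k := by
  obtain ⟨s, hs, hd⟩ := exists_dist_eq_setDist (G := G) hS x
  rw [h] at hd
  obtain ⟨p, hp⟩ := hG.exists_walk_length_eq_dist x s
  rw [hd] at hp
  cases p with
  | nil => simp at hp
  | cons hadj p =>
    rename_i y
    rw [SimpleGraph.Walk.length_cons] at hp
    have h1 := setDist_le (G := G) hs y
    have h2 := SimpleGraph.dist_le p
    have h3 := setDist_le_of_adj hG hS hadj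
    exact ⟨y, hadj, by omega⟩

/-- A shortest path from a set to a vertex. -/
theorem exists_chain_setDist (hG : G.Connected) (hS : S.Nonempty) (k : ℕ) :
    ∀ x, setDist G S x = k → ∃ w : ℕ → V, w k = x ∧ (∀ i ≤ k, setDist G S (w i) = i) ∧
      ∀ i < k, G.Adj (w i) (w (i + 1)) := by
  induction k with
  | zero =>
    intro x hx
    exact ⟨fun _ => x, rfl, fun i hi => by rw [hx]; omega, fun i hi => by omega⟩
  | succ k ih =>
    intro x hx
    obtain ⟨y, hxy, hy⟩ := exists_adj_setDist hG hS hx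
    obtain ⟨w, hw, hd, ha⟩ := ih y hy
    refine ⟨fun i => if i ≤ k then w i else x, by simp, ?_, ?_⟩
    · intro i hi
      by_cases h : i ≤ k
      · simpa [h] using hd i h
      · simp only [h, if_false]
        omega
    · intro i hi
      by_cases h : i + 1 ≤ k
      · simpa [h, show i ≤ k by omega] using ha i (by omega)
      · have : i = k := by omega
        subst this
        simpa [hw] using hxy.symm

theorem IndepBound.setDist_le {n : ℕ} (hG : G.Connected) (hS : S.Nonempty)
    (hstar : ¬ (starK (n + 1)).IsIndContained G) (hkstar : ¬ (kStar (n + 1)).IsIndContained G)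
    {a : ℕ} (ha : IndepBound G S a) (k : ℕ) :
    IndepBound G {x | setDist G S x ≤ k} ((nbhdBound n)^[k] a) := by
  induction k with
  | zero =>
    exact ha.mono fun x hx => (setDist_eq_zero hG hS).1 (Nat.le_zero.1 hx)
  | succ k ih =>
    rw [Function.iterate_succ_apply']
    refine (ih.closedNbhd hstar hkstar).mono fun x hx => ?_
    rcases Nat.lt_or_ge k (setDist G S x) with h | h
    · obtain ⟨y, hxy, hy⟩ := exists_adj_setDist hG hS (x := x) (k := k)
        (le_antisymm hx h)
      exact Or.inr ⟨y, hy.le, hxy.symm⟩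
    · exact Or.inl h

end Level

/-! ### Path covers by lists of vertices -/

section ListPaths

variable {V : Type u} {G : SimpleGraph V}

/-- A path in `G`, given by the nonempty list of its vertices. -/
structure IsListPath (G : SimpleGraph V) (l : List V) : Prop where
  ne_nil : l ≠ []
  chain : l.IsChain G.Adj
  nodup : l.Nodup

/-- The path subgraph spanned by consecutive vertices of a list. -/
theorem IsListPath.exists_subgraph {l : List V} (h : IsListPath G l) :
    ∃ P : G.Subgraph, P.IsPathSubgraph ∧ ∀ x, x ∈ P.verts ↔ x ∈ l := by
  have hadj : ∀ i (hi : i + 1 < l.length), G.Adj l[i] l[i + 1] :=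
    fun i hi => List.isChain_iff_getElem.1 h.chain i hi
  let f : SimpleGraph.Copy (SimpleGraph.pathGraph l.length) G :=
    ⟨⟨fun i => l[i], by
      intro i j hij
      rw [SimpleGraph.pathGraph_adj] at hij
      rcases hij with hij | hij
      · have := hadj i.1 (by omega)
        simpa [hij] using this
      · have := (hadj j.1 (by omega)).symm
        simpa [hij] using this⟩, by
      intro i j hij
      exact Fin.ext ((List.Nodup.getElem_inj_iff h.nodup).1 hij)⟩
  refine ⟨f.toSubgraph, ⟨l.length, List.length_pos_iff.2 h.ne_nil, ⟨f.isoToSubgraph.symm⟩⟩, ?_⟩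
  intro x
  simp only [SimpleGraph.Copy.toSubgraph, SimpleGraph.Subgraph.map_verts,
    SimpleGraph.Subgraph.verts_top, Set.image_univ, Set.mem_range]
  constructor
  · rintro ⟨i, rfl⟩
    exact List.getElem_mem i.2
  · intro hx
    obtain ⟨i, hi, rfl⟩ := List.getElem_of_mem hx
    exact ⟨⟨i, hi⟩, rfl⟩

/-- `S` is contained in the union of at most `k` paths of `G`. -/
def HasCover (G : SimpleGraph V) (S : Set V) (k : ℕ) : Prop :=
  ∃ L : List (List V), L.length ≤ k ∧ (∀ l ∈ L, IsListPath G l) ∧ ∀ x ∈ S, x ∈ L.flatten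

/-- `S` is the disjoint union of the vertex sets of at most `k` paths of `G`. -/
def HasPartition (G : SimpleGraph V) (S : Set V) (k : ℕ) : Prop :=
  ∃ L : List (List V), L.length ≤ k ∧ (∀ l ∈ L, IsListPath G l) ∧ L.flatten.Nodup ∧
    ∀ x, x ∈ L.flatten ↔ x ∈ S

theorem HasPartition.hasCover {S : Set V} {k : ℕ} (h : HasPartition G S k) : HasCover G S k := by
  obtain ⟨L, h1, h2, -, h4⟩ := h
  exact ⟨L, h1, h2, fun x hx => (h4 x).2 hx⟩

theorem HasCover.mono {S : Set V} {k k' : ℕ} (h : HasCover G S k) (hk : k ≤ k') :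
    HasCover G S k' := by
  obtain ⟨L, h1, h2⟩ := h
  exact ⟨L, h1.trans hk, h2⟩

theorem HasPartition.mono {S : Set V} {k k' : ℕ} (h : HasPartition G S k) (hk : k ≤ k') :
    HasPartition G S k' := by
  obtain ⟨L, h1, h2⟩ := h
  exact ⟨L, h1.trans hk, h2⟩

theorem HasCover.union {S T : Set V} {k k' : ℕ} (h : HasCover G S k) (h' : HasCover G T k') :
    HasCover G (S ∪ T) (k + k') := by
  obtain ⟨L, h1, h2, h3⟩ := h
  obtain ⟨L', h1', h2', h3'⟩ := h'
  refine ⟨L ++ L', by simp; omega, fun l hl => (List.mem_append.1 hl).elim (h2 l) (h2' l), ?_⟩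
  intro x hx
  rw [List.flatten_append, List.mem_append]
  exact hx.imp (h3 x) (h3' x)

theorem HasPartition.union {S T : Set V} {k k' : ℕ} (h : HasPartition G S k)
    (h' : HasPartition G T k') (hST : Disjoint S T) : HasPartition G (S ∪ T) (k + k') := by
  obtain ⟨L, h1, h2, h3, h4⟩ := h
  obtain ⟨L', h1', h2', h3', h4'⟩ := h'
  refine ⟨L ++ L', by simp; omega, fun l hl => (List.mem_append.1 hl).elim (h2 l) (h2' l), ?_, ?_⟩
  · rw [List.flatten_append]
    refine h3.append h3' fun x hx hx' => Set.disjoint_left.1 hST ((h4 x).1 hx) ((h4' x).1 hx')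
  · intro x
    rw [List.flatten_append, List.mem_append, h4, h4', Set.mem_union]

theorem HasCover.pathCoverNumber_le {k : ℕ} (h : HasCover G Set.univ k) :
    pathCoverNumber G ≤ k := by
  classical
  obtain ⟨L, h1, h2, h3⟩ := h
  choose! P hP hv using fun l hl => (h2 l hl).exists_subgraph
  suffices hle : pathCoverNumber G ≤ (L.toFinset.image P).card from
    hle.trans (Finset.card_image_le.trans ((List.toFinset_card_le L).trans h1))
  refine Nat.sInf_le ⟨L.toFinset.image P, ⟨?_, ?_⟩, rfl⟩
  · intro Q hQ
    obtain ⟨l, hl, rfl⟩ := Finset.mem_image.1 hQ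
    exact hP l (List.mem_toFinset.1 hl)
  · intro x
    obtain ⟨l, hl, hx⟩ := List.mem_flatten.1 (h3 x trivial)
    exact ⟨P l, Finset.mem_image_of_mem _ (List.mem_toFinset.2 hl), (hv l hl x).2 hx⟩

theorem HasPartition.pathPartitionNumber_le {k : ℕ} (h : HasPartition G Set.univ k) :
    pathPartitionNumber G ≤ k := by
  classical
  obtain ⟨L, h1, h2, h3, h4⟩ := h
  choose! P hP hv using fun l hl => (h2 l hl).exists_subgraph
  suffices hle : pathPartitionNumber G ≤ (L.toFinset.image P).card from
    hle.trans (Finset.card_image_le.trans ((List.toFinset_card_le L).trans h1))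
  refine Nat.sInf_le ⟨L.toFinset.image P, ⟨⟨?_, ?_⟩, ?_⟩, rfl⟩
  · intro Q hQ
    obtain ⟨l, hl, rfl⟩ := Finset.mem_image.1 hQ
    exact hP l (List.mem_toFinset.1 hl)
  · intro x
    obtain ⟨l, hl, hx⟩ := List.mem_flatten.1 ((h4 x).2 trivial)
    exact ⟨P l, Finset.mem_image_of_mem _ (List.mem_toFinset.2 hl), (hv l hl x).2 hx⟩
  · intro Q hQ Q' hQ' hne
    obtain ⟨l, hl, rfl⟩ := Finset.mem_image.1 hQ
    obtain ⟨l', hl', rfl⟩ := Finset.mem_image.1 hQ'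
    rw [List.mem_toFinset] at hl hl'
    rw [Set.disjoint_left]
    intro x hx hx'
    rw [hv l hl] at hx
    rw [hv l' hl'] at hx'
    have hpw := (List.nodup_flatten.1 h3).2
    have : l ≠ l' := fun h => hne (by rw [h])
    have : Std.Symm (List.Disjoint (α := V)) := ⟨fun _ _ h => h.symm⟩
    exact hpw.forall hl hl' ‹l ≠ l'› hx hx'

theorem List.exists_perm_of_not_pairwise {α : Type*} {R : α → α → Prop} {L : List α}
    (h : ¬ L.Pairwise R) : ∃ a b L', L.Perm (a :: b :: L') ∧ ¬ R a b := by
  induction L with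
  | nil => simp at h
  | cons a L ih =>
    rw [List.pairwise_cons, not_and_or] at h
    rcases h with h | h
    · push Not at h
      obtain ⟨b, hb, hab⟩ := h
      obtain ⟨s, t, rfl⟩ := List.mem_iff_append.1 hb
      exact ⟨a, b, s ++ t, List.perm_middle.cons a, hab⟩
    · obtain ⟨b, c, L', hL', hbc⟩ := ih h
      exact ⟨b, c, a :: L', (hL'.cons a).trans
        ((List.Perm.swap b a _).trans ((List.Perm.swap c a _).cons b)), hbc⟩

/-- A set with independence number at most `k` is the disjoint union of at most `k` paths: in a
partition with the fewest paths, the first vertices of the paths are independent, since two paths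
with adjacent first vertices can be joined. -/
theorem IndepBound.hasPartition {S : Set V} (hfin : S.Finite) {k : ℕ} (h : IndepBound G S k) :
    HasPartition G S k := by
  classical
  have hex : ∃ m, HasPartition G S m := by
    refine ⟨_, hfin.toFinset.toList.map fun x => [x], le_rfl, ?_, ?_, ?_⟩
    · intro l hl
      obtain ⟨x, -, rfl⟩ := List.mem_map.1 hl
      exact ⟨by simp, by simp, by simp⟩
    · rw [← List.flatMap_def, List.flatMap_singleton']
      exact Finset.nodup_toList _
    · simp
  obtain ⟨L, h1, h2, h3, h4⟩ := Nat.find_spec hex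
  have hmin : ∀ m, HasPartition G S m → Nat.find hex ≤ m := fun m hm => Nat.find_min' hex hm
  have hpw : L.Pairwise fun l l' => ∀ x ∈ l.head?, ∀ y ∈ l'.head?, ¬ G.Adj x y := by
    by_contra hno
    obtain ⟨l, l', L', hperm, hadj⟩ := List.exists_perm_of_not_pairwise hno
    push Not at hadj
    obtain ⟨x, hx, y, hy, hxy⟩ := hadj
    have hl := h2 l (hperm.mem_iff.2 (by simp))
    have hl' := h2 l' (hperm.mem_iff.2 (by simp))
    have hlen := hperm.length_eq
    have hpf : L.flatten.Perm ((l.reverse ++ l') :: L').flatten := by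
      refine hperm.flatten.trans ?_
      simp only [List.flatten_cons, List.append_assoc]
      exact List.Perm.append_right _ (List.reverse_perm l).symm
    have hnd := (hpf.nodup_iff).1 h3
    have := hmin (L'.length + 1) ⟨(l.reverse ++ l') :: L', by simp, ?_, hnd, ?_⟩
    · simp at hlen
      omega
    · intro m hm
      rcases List.mem_cons.1 hm with rfl | hm
      · refine ⟨by simp [hl.ne_nil], ?_, ?_⟩
        · rw [List.isChain_append]
          refine ⟨?_, hl'.chain, ?_⟩
          · rw [List.isChain_reverse]
            exact hl.chain.imp fun _ _ h => h.symm
          · intro a ha b hb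
            rw [List.getLast?_reverse] at ha
            rw [Option.mem_unique ha hx, Option.mem_unique hb hy]
            exact hxy
        · exact (List.nodup_flatten.1 hnd).1 _ (by simp)
      · exact h2 m (hperm.mem_iff.2 (by simp [hm]))
    · intro z
      rw [← hpf.mem_iff, h4]
  refine ⟨L, ?_, h2, h3, h4⟩
  have hnd := List.nodup_flatten.1 h3
  have hhead : ∀ l ∈ L, ∃ x, l.head? = some x := fun l hl => by
    obtain ⟨x, hx⟩ := List.exists_mem_of_ne_nil l (h2 l hl).ne_nil
    rcases l with _ | ⟨a, l⟩
    · simp at hx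
    · exact ⟨a, rfl⟩
  by_cases hL : L = []
  · rw [hL]
    exact Nat.zero_le _
  obtain ⟨l₀, hl₀⟩ := List.exists_mem_of_ne_nil L hL
  have : Nonempty V := ⟨(hhead l₀ hl₀).choose⟩
  choose! f hf using hhead
  have hfmem : ∀ l ∈ L, f l ∈ l := fun l hl => List.mem_of_head? (hf l hl)
  have hne : L.Pairwise fun l l' => f l ≠ f l' := hnd.2.imp_of_mem fun hl hl' hdis heq =>
    hdis (hfmem _ hl) (heq ▸ hfmem _ hl')
  have hLnd : (L.map f).Nodup := List.pairwise_map.2 hne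
  have hcard := h (L.map f).toFinset (by
    intro x hx
    obtain ⟨l, hl, rfl⟩ := List.mem_map.1 (List.mem_toFinset.1 hx)
    exact (h4 _).1 (List.mem_flatten.2 ⟨l, hl, hfmem l hl⟩)) (by
    intro x hx y hy hxy
    obtain ⟨l, hl, rfl⟩ := List.mem_map.1 (List.mem_toFinset.1 hx)
    obtain ⟨l', hl', rfl⟩ := List.mem_map.1 (List.mem_toFinset.1 hy)
    have : Std.Symm fun l l' : List V => ∀ x ∈ l.head?, ∀ y ∈ l'.head?, ¬ G.Adj x y :=
      ⟨fun _ _ h x hx y hy hxy => h y hy x hx hxy.symm⟩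
    exact hpw.forall hl hl'
      (fun h => hxy (by rw [h])) _ (hf l hl) _ (hf l' hl'))
  rw [List.toFinset_card_of_nodup hLnd, List.length_map] at hcard
  exact hcard

end ListPaths

/-! ### Induced paths -/

section InducedPaths

variable {V : Type u} {G : SimpleGraph V}

/-- The vertices `z 0, …, z L` form an induced path of `G`, in this order. -/
structure IsIndPath (G : SimpleGraph V) (z : ℕ → V) (L : ℕ) : Prop where
  inj : ∀ i ≤ L, ∀ j ≤ L, z i = z j → i = j
  adj : ∀ i ≤ L, ∀ j ≤ L, G.Adj (z i) (z j) ↔ i + 1 = j ∨ j + 1 = i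

theorem IsIndPath.reverse {z : ℕ → V} {L : ℕ} (h : IsIndPath G z L) :
    IsIndPath G (fun i => z (L - i)) L := by
  refine ⟨fun i hi j hj hij => ?_, fun i hi j hj => ?_⟩
  · have := h.inj _ (by omega) _ (by omega) hij
    omega
  · rw [h.adj _ (by omega) _ (by omega)]
    omega

theorem IsIndPath.lt_card [Fintype V] {z : ℕ → V} {L : ℕ} (h : IsIndPath G z L) :
    L < Fintype.card V := by
  have := Fintype.card_le_of_injective (fun i : Fin (L + 1) => z i)
    (fun i j hij => Fin.ext (h.inj _ (by omega) _ (by omega) hij))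
  simpa using this

/-- Concatenation of an induced path ending in `w 1` with the final segment of `z` starting at
`z c`, where `c` is the last neighbour of `w 1` on `z`. -/
theorem IsIndPath.join {z w : ℕ → V} {L m c : ℕ} (hz : IsIndPath G z L)
    (hw : IsIndPath G (fun i => w (i + 1)) m) (hc : c ≤ L)
    (hne : ∀ i, 1 ≤ i → i ≤ m + 1 → ∀ j, c ≤ j → j ≤ L → w i ≠ z j)
    (hadj : ∀ i, 1 ≤ i → i ≤ m + 1 → ∀ j, c ≤ j → j ≤ L → (G.Adj (w i) (z j) ↔ i = 1 ∧ j = c)) :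
    IsIndPath G (fun i => if i ≤ m then w (m + 1 - i) else z (i - (m + 1) + c)) (m + 1 + (L - c)) := by
  refine ⟨fun i hi j hj hij => ?_, fun i hi j hj => ?_⟩
  · split_ifs at hij with h1 h2 h2
    · have := hw.inj (m - i) (by omega) (m - j) (by omega)
        (by simpa [show m - i + 1 = m + 1 - i by omega, show m - j + 1 = m + 1 - j by omega] using hij)
      omega
    · exact absurd hij (hne _ (by omega) (by omega) _ (by omega) (by omega))
    · exact absurd hij.symm (hne _ (by omega) (by omega) _ (by omega) (by omega))
    · have := hz.inj _ (by omega) _ (by omega) hij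
      omega
  · split_ifs with h1 h2 h2
    · have := hw.adj (m - i) (by omega) (m - j) (by omega)
      simp only [show m - i + 1 = m + 1 - i by omega, show m - j + 1 = m + 1 - j by omega] at this
      rw [this]
      omega
    · rw [hadj _ (by omega) (by omega) _ (by omega) (by omega)]
      omega
    · rw [G.adj_comm, hadj _ (by omega) (by omega) _ (by omega) (by omega)]
      omega
    · rw [hz.adj _ (by omega) _ (by omega)]
      omega

/-- A vertex off an induced path whose first and last neighbours on the path are `z a` and `z b`
yields an induced path in which it replaces the vertices strictly between these two. -/
theorem IsIndPath.splice {z : ℕ → V} {L a b : ℕ} {v : V} (hz : IsIndPath G z L) (hab : a + 2 ≤ b)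
    (hb : b ≤ L) (hv : ∀ i ≤ L, v ≠ z i) (ha : G.Adj v (z a)) (hb' : G.Adj v (z b))
    (hfirst : ∀ i ≤ L, G.Adj v (z i) → a ≤ i ∧ i ≤ b) :
    IsIndPath G (fun i => if i ≤ a then z i else if i = a + 1 then v else z (i - (a + 2) + b))
      (a + 2 + (L - b)) := by
  have hva : ∀ i ≤ a, G.Adj v (z i) ↔ i = a := fun i hi =>
    ⟨fun h => by have := hfirst i (by omega) h; omega, fun h => h ▸ ha⟩
  have hvb : ∀ i ≤ L, b ≤ i → (G.Adj v (z i) ↔ i = b) := fun i hi hi' =>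
    ⟨fun h => by have := hfirst i (by omega) h; omega, fun h => h ▸ hb'⟩
  refine ⟨fun i hi j hj hij => ?_, fun i hi j hj => ?_⟩
  · split_ifs at hij with h1 h2 h2 h2 h2 h2 h2 h2
    all_goals first
      | omega
      | (have := hz.inj _ (by omega) _ (by omega) hij; omega)
      | exact absurd hij (hv _ (by omega))
      | exact absurd hij.symm (hv _ (by omega))
  · split_ifs with h1 h2 h2 h2 h2 h2 h2 h2
    all_goals first
      | exact (hz.adj _ (by omega) _ (by omega)).trans (by omega)
      | exact (hva _ (by omega)).trans (by omega)
      | exact (hvb _ (by omega) (by omega)).trans (by omega)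
      | exact (G.adj_comm _ _).trans ((hva _ (by omega)).trans (by omega))
      | exact (G.adj_comm _ _).trans ((hvb _ (by omega) (by omega)).trans (by omega))
      | exact iff_of_false G.irrefl (by omega)

/-- An induced path with a further vertex attached to one of its inner vertices. -/
theorem IsIndPath.isIndContained_F1 {p : ℕ → V} {M c n : ℕ} {x : V} (hp : IsIndPath G p M)
    (h1 : n ≤ c) (h2 : c + n ≤ M) (hx : ∀ i, c ≤ i + n → i ≤ c + n → x ≠ p i)
    (hadj : ∀ i, c ≤ i + n → i ≤ c + n → (G.Adj x (p i) ↔ i = c)) :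
    (fGraph false false n).IsIndContained G := by
  refine IsFCopy.isIndContained (x₁ := p c) (x₂ := x) (y := fun i => p (c - 1 - i))
    (z := fun i => p (c + 1 + i)) ?_
  constructor
  · intro i hi j hj h; have := hp.inj _ (by omega) _ (by omega) h; omega
  · intro i hi j hj; rw [hp.adj _ (by omega) _ (by omega)]; omega
  · intro i hi j hj h; have := hp.inj _ (by omega) _ (by omega) h; omega
  · intro i hi j hj; rw [hp.adj _ (by omega) _ (by omega)]; omega
  · intro i hi j hj h; have := hp.inj _ (by omega) _ (by omega) h; omega
  · intro i hi j hj; rw [hp.adj _ (by omega) _ (by omega)]; simp; omega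
  · exact (hx c (by omega) (by omega)).symm
  · rw [G.adj_comm, hadj c (by omega) (by omega)]; simp
  · intro i hi h; have := hp.inj _ (by omega) _ (by omega) h; omega
  · intro i hi; rw [hp.adj _ (by omega) _ (by omega)]; omega
  · intro i hi h; have := hp.inj _ (by omega) _ (by omega) h; omega
  · intro i hi; rw [hp.adj _ (by omega) _ (by omega)]; omega
  · intro i hi; exact hx _ (by omega) (by omega)
  · intro i hi; rw [hadj _ (by omega) (by omega)]; simp; omega
  · intro i hi; exact hx _ (by omega) (by omega)
  · intro i hi; rw [hadj _ (by omega) (by omega)]; simp; omega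

/-- An induced path with a further vertex attached to both neighbours of an inner vertex. -/
theorem IsIndPath.isIndContained_F3 {p : ℕ → V} {M c n : ℕ} {x : V} (hp : IsIndPath G p M)
    (h1 : n ≤ c) (h2 : c + n ≤ M) (hx : ∀ i, c ≤ i + n → i ≤ c + n → x ≠ p i)
    (hadj : ∀ i, c ≤ i + n → i ≤ c + n → (G.Adj x (p i) ↔ i + 1 = c ∨ i = c + 1)) :
    (fGraph false true n).IsIndContained G := by
  refine IsFCopy.isIndContained (x₁ := p c) (x₂ := x) (y := fun i => p (c - 1 - i))
    (z := fun i => p (c + 1 + i)) ?_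
  constructor
  · intro i hi j hj h; have := hp.inj _ (by omega) _ (by omega) h; omega
  · intro i hi j hj; rw [hp.adj _ (by omega) _ (by omega)]; omega
  · intro i hi j hj h; have := hp.inj _ (by omega) _ (by omega) h; omega
  · intro i hi j hj; rw [hp.adj _ (by omega) _ (by omega)]; omega
  · intro i hi j hj h; have := hp.inj _ (by omega) _ (by omega) h; omega
  · intro i hi j hj; rw [hp.adj _ (by omega) _ (by omega)]; simp; omega
  · exact (hx c (by omega) (by omega)).symm
  · rw [G.adj_comm, hadj c (by omega) (by omega)]; simp
  · intro i hi h; have := hp.inj _ (by omega) _ (by omega) h; omega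
  · intro i hi; rw [hp.adj _ (by omega) _ (by omega)]; omega
  · intro i hi h; have := hp.inj _ (by omega) _ (by omega) h; omega
  · intro i hi; rw [hp.adj _ (by omega) _ (by omega)]; omega
  · intro i hi; exact hx _ (by omega) (by omega)
  · intro i hi; rw [hadj _ (by omega) (by omega)]; simp; omega
  · intro i hi; exact hx _ (by omega) (by omega)
  · intro i hi; rw [hadj _ (by omega) (by omega)]; simp; omega

/-- An induced path with a triangle on an inner edge and a vertex attached to its apex. -/
theorem IsIndPath.isIndContained_F2 {p : ℕ → V} {M c n : ℕ} {x₁ x₂ : V} (hp : IsIndPath G p M)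
    (h1 : n ≤ c + 1) (h2 : c + n ≤ M) (hx₁ : ∀ i, c < i + n → i ≤ c + n → x₁ ≠ p i)
    (hadj₁ : ∀ i, c < i + n → i ≤ c + n → (G.Adj x₁ (p i) ↔ i = c ∨ i = c + 1))
    (hx₂ : ∀ i, c < i + n → i ≤ c + n → x₂ ≠ p i)
    (hadj₂ : ∀ i, c < i + n → i ≤ c + n → ¬ G.Adj x₂ (p i)) (hadj : G.Adj x₁ x₂) :
    (fGraph true false n).IsIndContained G := by
  refine IsFCopy.isIndContained (x₁ := x₁) (x₂ := x₂) (y := fun i => p (c - i))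
    (z := fun i => p (c + 1 + i)) ?_
  constructor
  · intro i hi j hj h; have := hp.inj _ (by omega) _ (by omega) h; omega
  · intro i hi j hj; rw [hp.adj _ (by omega) _ (by omega)]; omega
  · intro i hi j hj h; have := hp.inj _ (by omega) _ (by omega) h; omega
  · intro i hi j hj; rw [hp.adj _ (by omega) _ (by omega)]; omega
  · intro i hi j hj h; have := hp.inj _ (by omega) _ (by omega) h; omega
  · intro i hi j hj; rw [hp.adj _ (by omega) _ (by omega)]; simp; omega
  · exact hadj.ne
  · simpa using hadj
  · intro i hi; exact hx₁ _ (by omega) (by omega)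
  · intro i hi; rw [hadj₁ _ (by omega) (by omega)]; omega
  · intro i hi; exact hx₁ _ (by omega) (by omega)
  · intro i hi; rw [hadj₁ _ (by omega) (by omega)]; omega
  · intro i hi; exact hx₂ _ (by omega) (by omega)
  · intro i hi; simpa using hadj₂ (c - i) (by omega) (by omega)
  · intro i hi; exact hx₂ _ (by omega) (by omega)
  · intro i hi; simpa using hadj₂ (c + 1 + i) (by omega) (by omega)

/-- An induced path with two triangles on an inner edge whose apices are not adjacent. -/
theorem IsIndPath.isIndContained_F4 {p : ℕ → V} {M c n : ℕ} {x₁ x₂ : V} (hp : IsIndPath G p M)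
    (h1 : n ≤ c + 1) (h2 : c + n ≤ M) (hx₁ : ∀ i, c < i + n → i ≤ c + n → x₁ ≠ p i)
    (hadj₁ : ∀ i, c < i + n → i ≤ c + n → (G.Adj x₁ (p i) ↔ i = c ∨ i = c + 1))
    (hx₂ : ∀ i, c < i + n → i ≤ c + n → x₂ ≠ p i)
    (hadj₂ : ∀ i, c < i + n → i ≤ c + n → (G.Adj x₂ (p i) ↔ i = c ∨ i = c + 1))
    (hne : x₁ ≠ x₂) (hadj : ¬ G.Adj x₁ x₂) :
    (fGraph true true n).IsIndContained G := by
  refine IsFCopy.isIndContained (x₁ := x₁) (x₂ := x₂) (y := fun i => p (c - i))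
    (z := fun i => p (c + 1 + i)) ?_
  constructor
  · intro i hi j hj h; have := hp.inj _ (by omega) _ (by omega) h; omega
  · intro i hi j hj; rw [hp.adj _ (by omega) _ (by omega)]; omega
  · intro i hi j hj h; have := hp.inj _ (by omega) _ (by omega) h; omega
  · intro i hi j hj; rw [hp.adj _ (by omega) _ (by omega)]; omega
  · intro i hi j hj h; have := hp.inj _ (by omega) _ (by omega) h; omega
  · intro i hi j hj; rw [hp.adj _ (by omega) _ (by omega)]; simp; omega
  · exact hne
  · simpa using hadj
  · intro i hi; exact hx₁ _ (by omega) (by omega)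
  · intro i hi; rw [hadj₁ _ (by omega) (by omega)]; omega
  · intro i hi; exact hx₁ _ (by omega) (by omega)
  · intro i hi; rw [hadj₁ _ (by omega) (by omega)]; omega
  · intro i hi; exact hx₂ _ (by omega) (by omega)
  · intro i hi; rw [hadj₂ _ (by omega) (by omega)]; simp; omega
  · intro i hi; exact hx₂ _ (by omega) (by omega)
  · intro i hi; rw [hadj₂ _ (by omega) (by omega)]; simp; omega

end InducedPaths

/-! ### Vertices attached to an induced path -/

section Attached

variable {V : Type u} {G : SimpleGraph V} {z : ℕ → V} {L m n a b : ℕ} {v w : V}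

/-- `v` lies off the path `z 0, …, z L`, has a neighbour on it, and all its neighbours on it are at
distance at least `m` from both ends. -/
structure IsAttached (G : SimpleGraph V) (z : ℕ → V) (L m : ℕ) (v : V) : Prop where
  ne : ∀ i ≤ L, v ≠ z i
  exists_adj : ∃ i ≤ L, G.Adj v (z i)
  inner : ∀ i ≤ L, G.Adj v (z i) → m ≤ i ∧ i + m ≤ L

/-- `z a` and `z b` are the first and the last neighbour of `v` on the path `z 0, …, z L`. -/
structure IsSpan (G : SimpleGraph V) (z : ℕ → V) (L : ℕ) (v : V) (a b : ℕ) : Prop where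
  le : b ≤ L
  adj_first : G.Adj v (z a)
  adj_last : G.Adj v (z b)
  mem : ∀ i ≤ L, G.Adj v (z i) → a ≤ i ∧ i ≤ b

theorem exists_isSpan (h : ∃ i ≤ L, G.Adj v (z i)) : ∃ a b, IsSpan G z L v a b := by
  classical
  set s := (Finset.range (L + 1)).filter (fun i => G.Adj v (z i)) with hs
  have hmem : ∀ i, i ∈ s ↔ i ≤ L ∧ G.Adj v (z i) := by
    intro i
    rw [hs, Finset.mem_filter, Finset.mem_range, Nat.lt_succ_iff]
  obtain ⟨i, hi, hadj⟩ := h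
  have hne : s.Nonempty := ⟨i, (hmem i).2 ⟨hi, hadj⟩⟩
  refine ⟨s.min' hne, s.max' hne, ((hmem _).1 (s.max'_mem hne)).1, ((hmem _).1 (s.min'_mem hne)).2,
    ((hmem _).1 (s.max'_mem hne)).2, fun j hj hadj => ?_⟩
  have := (hmem j).2 ⟨hj, hadj⟩
  exact ⟨s.min'_le _ this, s.le_max' _ this⟩

theorem IsSpan.first_le (h : IsSpan G z L v a b) : a ≤ b := (h.mem b h.le h.adj_last).1

theorem IsAttached.isSpan_bounds (hv : IsAttached G z L m v) (h : IsSpan G z L v a b) :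
    m ≤ a ∧ b + m ≤ L :=
  ⟨(hv.inner a (h.first_le.trans h.le) h.adj_first).1, (hv.inner b h.le h.adj_last).2⟩

/-- An attached vertex with a single neighbour on the path would yield `F^{(1)}`. -/
theorem IsAttached.first_lt_last (hz : IsIndPath G z L) (hm : n ≤ m)
    (hF1 : ¬ (fGraph false false n).IsIndContained G) (hv : IsAttached G z L m v)
    (h : IsSpan G z L v a b) : a < b := by
  by_contra hab
  have hle := h.first_le
  have hbd := hv.isSpan_bounds h
  refine hF1 (hz.isIndContained_F1 (c := a) (x := v) (by omega) (by omega)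
    (fun i _ hi => hv.ne i (by omega)) fun i _ hi => ⟨fun hadj => ?_, fun hi => hi ▸ h.adj_first⟩)
  have := h.mem i (by omega) hadj
  omega

/-- No vertex at distance two from the path is adjacent to an attached vertex `v`: if the first and
the last neighbour of `v` are consecutive on the path, such a vertex yields `F^{(2)}`, and otherwise
it yields `F^{(1)}` on the path that is rerouted through `v`. -/
theorem IsAttached.no_pendant (hz : IsIndPath G z L) (hm : n + 1 ≤ m)
    (hF1 : ¬ (fGraph false false n).IsIndContained G)
    (hF2 : ¬ (fGraph true false n).IsIndContained G) (hv : IsAttached G z L m v)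
    (hvw : G.Adj v w) (hw : ∀ i ≤ L, w ≠ z i) (hwz : ∀ i ≤ L, ¬ G.Adj w (z i)) : False := by
  obtain ⟨a, b, h⟩ := exists_isSpan hv.exists_adj
  have hlt := hv.first_lt_last hz (by omega) hF1 h
  have hbd := hv.isSpan_bounds h
  have hle := h.le
  rcases Nat.lt_or_ge (a + 1) b with hab | hab
  · have hp := hz.splice hab h.le hv.ne h.adj_first h.adj_last h.mem
    refine hF1 (hp.isIndContained_F1 (c := a + 1) (x := w) (by omega) (by omega) ?_ ?_)
    · intro i hi hi'
      split_ifs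
      · exact hw _ (by omega)
      · exact hvw.ne'
      · exact hw _ (by omega)
    · intro i hi hi'
      split_ifs
      · exact iff_of_false (hwz _ (by omega)) (by omega)
      · exact iff_of_true hvw.symm (by omega)
      · exact iff_of_false (hwz _ (by omega)) (by omega)
  · obtain rfl : b = a + 1 := by omega
    refine hF2 (hz.isIndContained_F2 (c := a) (x₁ := v) (x₂ := w) (by omega) (by omega)
      (fun i _ _ => hv.ne i (by omega)) (fun i _ _ => ⟨fun hadj => ?_, ?_⟩)
      (fun i _ _ => hw i (by omega)) (fun i _ _ => hwz i (by omega)) hvw)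
    · have := h.mem i (by omega) hadj
      omega
    · rintro (rfl | rfl)
      · exact h.adj_first
      · exact h.adj_last

/-- Replace a segment of the path by the vertex `w` attached to it. A vertex `x` which is not
adjacent to `w` and whose first neighbour on the path is that of `w` must also be adjacent to the
last neighbour of `w`, which yields `F^{(3)}`. -/
theorem IsAttached.adj_last_of_not_adj {x : V} (hz : IsIndPath G z L) (hm : n + 1 ≤ m)
    (hF1 : ¬ (fGraph false false n).IsIndContained G) (hw : IsAttached G z L m w)
    (h : IsSpan G z L w a b) (hab : a + 2 ≤ b) (hxw : x ≠ w) (hxw' : ¬ G.Adj x w)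
    (hx : ∀ i ≤ L, i ≤ a ∨ b ≤ i → x ≠ z i) (hxa : G.Adj x (z a))
    (hxz : ∀ i ≤ L, i < a ∨ b < i → ¬ G.Adj x (z i)) :
    G.Adj x (z b) ∧ (fGraph false true n).IsIndContained G := by
  have hbd := hw.isSpan_bounds h
  have hp := hz.splice hab h.le hw.ne h.adj_first h.adj_last h.mem
  have hne : ∀ i, i ≤ a + 1 + n →
      x ≠ (if i ≤ a then z i else if i = a + 1 then w else z (i - (a + 2) + b)) := by
    intro i hi
    split_ifs
    · exact hx _ (by omega) (by omega)
    · exact hxw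
    · exact hx _ (by omega) (by omega)
  have hxb : G.Adj x (z b) := by
    by_contra hxb
    refine hF1 (hp.isIndContained_F1 (c := a) (x := x) (by omega) (by omega)
      (fun i _ hi => hne i (by omega)) ?_)
    intro i hi hi'
    split_ifs with h1 h2
    · rcases h1.lt_or_eq with h3 | rfl
      · exact iff_of_false (hxz _ (by omega) (by omega)) (by omega)
      · exact iff_of_true hxa rfl
    · exact iff_of_false hxw' (by omega)
    · rcases Nat.lt_or_ge (a + 2) i with h3 | h3
      · exact iff_of_false (hxz _ (by omega) (by omega)) (by omega)
      · rw [show i - (a + 2) + b = b by omega]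
        exact iff_of_false hxb (by omega)
  refine ⟨hxb, hp.isIndContained_F3 (c := a + 1) (x := x) (by omega) (by omega)
      (fun i _ hi => hne i (by omega)) ?_⟩
  intro i hi hi'
  split_ifs with h1 h2
  · rcases h1.lt_or_eq with h3 | rfl
    · exact iff_of_false (hxz _ (by omega) (by omega)) (by omega)
    · exact iff_of_true hxa (by omega)
  · exact iff_of_false hxw' (by omega)
  · rcases Nat.lt_or_ge (a + 2) i with h3 | h3
    · exact iff_of_false (hxz _ (by omega) (by omega)) (by omega)
    · rw [show i - (a + 2) + b = b by omega]
      exact iff_of_true hxb (by omega)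

/-- An attached vertex is adjacent to the vertex after its first neighbour, unless its neighbours
are two vertices at distance two on the path, which yields `F^{(3)}`. -/
theorem IsAttached.adj_succ_or (hz : IsIndPath G z L) (hm : n + 1 ≤ m)
    (hF1 : ¬ (fGraph false false n).IsIndContained G) (hv : IsAttached G z L m v)
    (h : IsSpan G z L v a b) : G.Adj v (z (a + 1)) ∨
      (G.Adj v (z (a + 2)) ∧ (fGraph false true n).IsIndContained G) := by
  by_cases hadj : G.Adj v (z (a + 1))
  · exact Or.inl hadj
  right
  have hbd := hv.isSpan_bounds h
  have hlt := hv.first_lt_last hz (by omega) hF1 h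
  have hne : b ≠ a + 1 := fun hb => hadj (hb ▸ h.adj_last)
  obtain ⟨h1, h2⟩ := hv.adj_last_of_not_adj (x := z (a + 1)) hz hm hF1 h (by omega)
    (hv.ne _ (by omega)).symm (fun h => hadj h.symm)
    (fun i hi hi' heq => by have := hz.inj _ (by omega) _ hi heq; omega)
    ((hz.adj _ (by omega) _ (by omega)).2 (by omega))
    (fun i hi hi' hadj => by have := (hz.adj _ (by omega) _ hi).1 hadj; omega)
  refine ⟨?_, h2⟩
  have := (hz.adj _ (by omega) _ h.le).1 h1
  obtain rfl : b = a + 2 := by omega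
  exact h.adj_last

/-- Attached vertices with the same first neighbour are adjacent, unless there is an induced
`F^{(3)}` or `F^{(4)}`. -/
theorem IsAttached.adj_of_first_eq {b' : ℕ} (hz : IsIndPath G z L) (hm : n + 1 ≤ m)
    (hF1 : ¬ (fGraph false false n).IsIndContained G)
    (hF3 : ¬ (fGraph false true n).IsIndContained G)
    (hF4 : ¬ (fGraph true true n).IsIndContained G)
    (hv : IsAttached G z L m v) (hw : IsAttached G z L m w)
    (h : IsSpan G z L v a b) (h' : IsSpan G z L w a b') (hvw : v ≠ w) : G.Adj v w := by
  wlog hle : b ≤ b' generalizing v w b b'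
  · exact (this hw hv h' h hvw.symm (by omega)).symm
  by_contra hadj
  have hlt := hv.first_lt_last hz (by omega) hF1 h
  have hbd := hw.isSpan_bounds h'
  rcases Nat.lt_or_ge (a + 1) b' with hab | hab
  · refine hF3 (hw.adj_last_of_not_adj (x := v) hz hm hF1 h' hab hvw hadj
      (fun i hi _ => hv.ne i hi) h.adj_first fun i hi hi' hvi => ?_).2
    have := h.mem i hi hvi
    omega
  · obtain rfl : b = a + 1 := by omega
    obtain rfl : b' = a + 1 := by omega
    have key : ∀ {x}, IsSpan G z L x a (a + 1) → ∀ i, i ≤ L →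
        (G.Adj x (z i) ↔ i = a ∨ i = a + 1) := by
      intro x hx i hi
      refine ⟨fun hadj => ?_, ?_⟩
      · have := hx.mem i hi hadj
        omega
      · rintro (rfl | rfl)
        · exact hx.adj_first
        · exact hx.adj_last
    exact hF4 (hz.isIndContained_F4 (c := a) (x₁ := v) (x₂ := w) (by omega) (by omega)
      (fun i _ _ => hv.ne i (by omega)) (fun i _ _ => key h i (by omega))
      (fun i _ _ => hw.ne i (by omega)) (fun i _ _ => key h' i (by omega)) hvw hadj)

end Attached

/-! ### Every vertex is close to a longest induced path -/

section Longest

variable {V : Type u} {G : SimpleGraph V} {z w : ℕ → V} {L n N c : ℕ}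

theorem IsIndPath.mono {L' : ℕ} (hz : IsIndPath G z L) (h : L' ≤ L) : IsIndPath G z L' :=
  ⟨fun i hi j hj => hz.inj i (hi.trans h) j (hj.trans h),
    fun i hi j hj => hz.adj i (hi.trans h) j (hj.trans h)⟩

/-- Let `w 1, …, w (N + 1)` be an induced path of which only `w 1` has neighbours on the longest
induced path `z`. If `z c` is a neighbour of `w 1` that is followed by `n` non-neighbours, then
there is an induced `F^{(1)}` or `F^{(2)}`. -/
theorem false_of_gap (hz : IsIndPath G z L) (hmax : ∀ z' L', IsIndPath G z' L' → L' ≤ L)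
    (hF1 : ¬ (fGraph false false n).IsIndContained G)
    (hF2 : ¬ (fGraph true false n).IsIndContained G)
    (hw : IsIndPath G (fun i => w (i + 1)) N) (hN : n ≤ N) (hN1 : 1 ≤ N)
    (hne : ∀ i, 1 ≤ i → i ≤ N + 1 → ∀ j ≤ L, w i ≠ z j)
    (hadj : ∀ i, 2 ≤ i → i ≤ N + 1 → ∀ j ≤ L, ¬ G.Adj (w i) (z j))
    (hcL : c + n ≤ L) (hc : G.Adj (w 1) (z c))
    (hgap : ∀ j, c < j → j ≤ c + n → ¬ G.Adj (w 1) (z j)) : False := by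
  have hp := (hz.mono hcL).join hw (by omega) (c := c)
    (fun i h1 h2 j h3 h4 => hne i h1 h2 j (by omega)) (by
      intro i h1 h2 j h3 h4
      rcases h1.lt_or_eq with h5 | rfl
      · exact iff_of_false (hadj i h5 h2 j (by omega)) (by omega)
      · rcases h3.lt_or_eq with h6 | rfl
        · exact iff_of_false (hgap j h6 h4) (by omega)
        · exact iff_of_true hc ⟨rfl, rfl⟩)
  rw [Nat.add_sub_cancel_left] at hp
  have hzw : ∀ t ≤ L, ∀ i ≤ N + 1 + n, (t < c ∨ c + n < t) →
      z t ≠ (if i ≤ N then w (N + 1 - i) else z (i - (N + 1) + c)) := by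
    intro t ht i hi htc
    split_ifs
    · exact (hne _ (by omega) (by omega) t ht).symm
    · intro h
      have := hz.inj t ht _ (by omega) h
      omega
  have hw1 : ∀ t ≤ L, ∀ i ≤ N, G.Adj (z t) (w (N + 1 - i)) ↔ i = N ∧ G.Adj (w 1) (z t) := by
    intro t ht i hi
    rcases hi.lt_or_eq with h | rfl
    · exact iff_of_false (fun h' => hadj _ (by omega) (by omega) t ht h'.symm) (by omega)
    · rw [Nat.add_sub_cancel_left, G.adj_comm]
      simp
  -- all neighbours of `w 1` on the path are `z c` and possibly `z (c - 1)`
  have honly : ∀ t ≤ L, G.Adj (w 1) (z t) → t = c ∨ t + 1 = c := by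
    intro t ht htadj
    by_contra hno
    have htc : t + 2 ≤ c ∨ c + n < t := by
      by_contra h
      exact hgap t (by omega) (by omega) htadj
    refine hF1 (hp.isIndContained_F1 (c := N) (x := z t) hN (by omega)
      (fun i _ hi => hzw t ht i (by omega) (by omega)) ?_)
    intro i hi hi'
    split_ifs with h
    · rw [hw1 t ht i h]
      simp [htadj]
    · rw [hz.adj _ ht _ (by omega)]
      omega
  by_cases hpred : ∃ d, d + 1 = c ∧ G.Adj (w 1) (z d)
  · obtain ⟨d, rfl, hd⟩ := hpred
    rcases d with _ | d
    · -- here `w` prolongs the path `z 1, …, z L`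
      have hlong := hz.join hw (c := 1) (by omega) (fun i h1 h2 j _ h4 => hne i h1 h2 j h4) (by
        intro i h1 h2 j h3 h4
        rcases h1.lt_or_eq with h5 | rfl
        · exact iff_of_false (hadj i h5 h2 j h4) (by omega)
        · refine ⟨fun h => ?_, fun h => by rw [h.2]; exact hc⟩
          have := honly j h4 h
          omega)
      have := hmax _ _ hlong
      omega
    · refine hF2 (hp.isIndContained_F2 (c := N) (x₁ := z (d + 1)) (x₂ := z d) (by omega) (by omega)
        (fun i _ hi => hzw _ (by omega) i (by omega) (by omega)) ?_
        (fun i _ hi => hzw _ (by omega) i (by omega) (by omega)) ?_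
        ((hz.adj _ (by omega) _ (by omega)).2 (by omega)))
      · intro i hi hi'
        split_ifs with h
        · rw [hw1 _ (by omega) i h]
          simp only [hd, and_true]
          omega
        · rw [hz.adj _ (by omega) _ (by omega)]
          omega
      · intro i hi hi'
        split_ifs with h
        · rw [hw1 _ (by omega) i h]
          rintro ⟨-, h⟩
          have := honly d (by omega) h
          omega
        · rw [hz.adj _ (by omega) _ (by omega)]
          omega
  · rcases c with _ | c
    · -- here `w` prolongs the path `z`
      have hlong := hz.join hw (c := 0) (by omega) (fun i h1 h2 j _ h4 => hne i h1 h2 j h4) (by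
        intro i h1 h2 j h3 h4
        rcases h1.lt_or_eq with h5 | rfl
        · exact iff_of_false (hadj i h5 h2 j h4) (by omega)
        · refine ⟨fun h => ?_, fun h => by rw [h.2]; exact hc⟩
          have := honly j h4 h
          omega)
      have := hmax _ _ hlong
      omega
    · refine hF1 (hp.isIndContained_F1 (c := N + 1) (x := z c) (by omega) (by omega)
        (fun i _ hi => hzw _ (by omega) i (by omega) (by omega)) ?_)
      intro i hi hi'
      split_ifs with h
      · rw [hw1 _ (by omega) i h]
        exact iff_of_false (fun h => hpred ⟨c, rfl, h.2⟩) (by omega)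
      · rw [hz.adj _ (by omega) _ (by omega)]
        omega

/-- In a `K_{1,s+1}`-free graph, a vertex has at most `2s` neighbours on an induced path. -/
theorem card_adj_le {s : ℕ} [DecidableRel G.Adj] (hz : IsIndPath G z L)
    (hstar : ¬ (starK (s + 1)).IsIndContained G)
    (x : V) : ((Finset.range (L + 1)).filter fun i => G.Adj x (z i)).card ≤ 2 * s := by
  classical
  set T := (Finset.range (L + 1)).filter fun i => G.Adj x (z i)
  have hT : ∀ i ∈ T, i ≤ L ∧ G.Adj x (z i) := fun i hi => by
    have := Finset.mem_filter.1 hi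
    exact ⟨Nat.lt_succ_iff.1 (Finset.mem_range.1 this.1), this.2⟩
  have hparity : ∀ T' ⊆ T, (∀ i ∈ T', ∀ j ∈ T', i + 1 ≠ j) → T'.card ≤ s := by
    intro T' hT' hind
    have hinj : Set.InjOn z T' := fun i hi j hj h =>
      hz.inj i (hT i (hT' hi)).1 j (hT j (hT' hj)).1 h
    rw [← Finset.card_image_of_injOn hinj]
    refine indepBound_neighborSet hstar x _ ?_ ?_
    · intro y hy
      obtain ⟨i, hi, rfl⟩ := Finset.mem_image.1 hy
      exact (hT i (hT' hi)).2
    · intro y hy y' hy' _ hadj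
      obtain ⟨i, hi, rfl⟩ := Finset.mem_image.1 hy
      obtain ⟨j, hj, rfl⟩ := Finset.mem_image.1 hy'
      rcases (hz.adj i (hT i (hT' hi)).1 j (hT j (hT' hj)).1).1 hadj with h | h
      · exact hind i hi j hj h
      · exact hind j hj i hi h
  have h1 := hparity (T.filter Even) (Finset.filter_subset _ _) (by
    intro i hi j hj h
    have hi' := (Finset.mem_filter.1 hi).2
    have hj' := (Finset.mem_filter.1 hj).2
    subst h
    exact (Nat.even_add_one.1 hj') hi')
  have h2 := hparity (T.filter (¬ Even ·)) (Finset.filter_subset _ _) (by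
    intro i hi j hj h
    have hi' := (Finset.mem_filter.1 hi).2
    have hj' := (Finset.mem_filter.1 hj).2
    subst h
    exact hj' (Nat.even_add_one.2 hi'))
  have := Finset.card_filter_add_card_filter_not (s := T) Even
  omega

/-- A shortest path from a set to a vertex is induced. -/
theorem isIndPath_of_setDist {S : Set V} {k o : ℕ} (hG : G.Connected) (hS : S.Nonempty)
    (hwd : ∀ i ≤ k, setDist G S (w i) = i) (hwa : ∀ i < k, G.Adj (w i) (w (i + 1)))
    (hk : N + o ≤ k) : IsIndPath G (fun i => w (i + o)) N := by
  have hinj : ∀ i ≤ k, ∀ j ≤ k, w i = w j → i = j := fun i hi j hj h => by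
    rw [← hwd i hi, ← hwd j hj, h]
  refine ⟨fun i hi j hj h => ?_, fun i hi j hj => ⟨fun h => ?_, ?_⟩⟩
  · have := hinj _ (by omega) _ (by omega) h
    omega
  · have h1 := setDist_le_of_adj hG hS h
    have h2 := setDist_le_of_adj hG hS h.symm
    rw [hwd _ (by omega), hwd _ (by omega)] at h1 h2
    have h3 : i ≠ j := fun h' => h.ne (by rw [h'])
    omega
  · rintro (rfl | rfl)
    · rw [show i + 1 + o = i + o + 1 by omega]
      exact hwa _ (by omega)
    · rw [show j + 1 + o = j + o + 1 by omega]
      exact (hwa _ (by omega)).symm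

/-- If the longest induced path `z` is long, every vertex has distance at most `n` from it: on
a longer shortest path to `z`, the vertex just before `z` has few neighbours on `z`, hence there are
many consecutive non-neighbours. -/
theorem setDist_le_of_longest {s : ℕ} (hG : G.Connected) (hz : IsIndPath G z L)
    (hmax : ∀ z' L', IsIndPath G z' L' → L' ≤ L) (hn : 1 ≤ n)
    (hstar : ¬ (starK (s + 1)).IsIndContained G)
    (hF1 : ¬ (fGraph false false n).IsIndContained G)
    (hF2 : ¬ (fGraph true false n).IsIndContained G)
    (hL : (2 * s + 1) * (n + 1) ≤ L) (x : V) : setDist G (z '' Set.Iic L) x ≤ n := by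
  classical
  by_contra! hx
  have hS : (z '' Set.Iic L).Nonempty := ⟨z 0, 0, by simp, rfl⟩
  obtain ⟨w, -, hwd, hwa⟩ := exists_chain_setDist hG hS _ x rfl
  have hwd' : ∀ i ≤ n + 1, setDist G (z '' Set.Iic L) (w i) = i := fun i hi => hwd i (by omega)
  have hw : IsIndPath G (fun i => w (i + 1)) n :=
    isIndPath_of_setDist hG hS hwd hwa (by omega)
  have hne : ∀ i, 1 ≤ i → i ≤ n + 1 → ∀ j ≤ L, w i ≠ z j := by
    intro i h1 h2 j hj h
    have := hwd' i h2
    rw [(setDist_eq_zero hG hS).2 ⟨j, hj, h.symm⟩] at this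
    omega
  have hadj : ∀ i, 2 ≤ i → i ≤ n + 1 → ∀ j ≤ L, ¬ G.Adj (w i) (z j) := by
    intro i h1 h2 j hj h
    have h3 := setDist_le_of_adj hG hS h
    rw [hwd' i h2, (setDist_eq_zero hG hS).2 ⟨j, hj, rfl⟩] at h3
    omega
  -- among `2s + 1` disjoint intervals of length `n + 1`, one contains no neighbour of `w 1`
  have hcard := card_adj_le hz hstar (w 1)
  obtain ⟨k, hk, hgap⟩ : ∃ k ≤ 2 * s, ∀ j, k * (n + 1) ≤ j → j < (k + 1) * (n + 1) →
      ¬ G.Adj (w 1) (z j) := by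
    by_contra! hno
    choose! f hf1 hf2 hf3 using hno
    have := Finset.card_le_card_of_injOn (s := Finset.range (2 * s + 1))
      (t := (Finset.range (L + 1)).filter fun i => G.Adj (w 1) (z i)) f (by
        intro k hk
        have hk' : k ≤ 2 * s := by simpa [Nat.lt_succ_iff] using hk
        have : (k + 1) * (n + 1) ≤ (2 * s + 1) * (n + 1) := Nat.mul_le_mul_right _ (by omega)
        have := hf2 k hk'
        simp only [Finset.coe_filter, Finset.mem_range, Set.mem_ofPred_eq]
        exact ⟨by omega, hf3 k hk'⟩) (by
        intro k hk k' hk' h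
        have h1 : k ≤ 2 * s := by simpa [Nat.lt_succ_iff] using hk
        have h2 : k' ≤ 2 * s := by simpa [Nat.lt_succ_iff] using hk'
        have hdiv : ∀ k ≤ 2 * s, f k / (n + 1) = k := fun k hk =>
          Nat.div_eq_of_lt_le (hf1 k hk) (hf2 k hk)
        rw [← hdiv k h1, ← hdiv k' h2, h])
    rw [Finset.card_range] at this
    omega
  have hkL : (k + 1) * (n + 1) ≤ L := (Nat.mul_le_mul_right _ (by omega)).trans hL
  rw [add_mul, one_mul] at hgap hkL
  have hw0 : ∃ i ≤ L, G.Adj (w 1) (z i) := by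
    obtain ⟨i, hi, h⟩ := (setDist_eq_zero hG hS).1 (hwd' 0 (by omega))
    exact ⟨i, hi, h ▸ (hwa 0 (by omega)).symm⟩
  by_cases hleft : ∃ i, i < k * (n + 1) ∧ G.Adj (w 1) (z i)
  · -- the last neighbour before the interval
    obtain ⟨i, hi, hi'⟩ := hleft
    obtain ⟨_, c, hspan⟩ := exists_isSpan (L := k * (n + 1) - 1) (z := z) ⟨i, by omega, hi'⟩
    have hle := hspan.le
    refine false_of_gap hz hmax hF1 hF2 hw le_rfl hn hne hadj (c := c) (by omega) hspan.adj_last ?_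
    intro j hj1 hj2 hj
    rcases Nat.lt_or_ge j (k * (n + 1)) with h | h
    · have := hspan.mem j (by omega) hj
      omega
    · exact hgap j h (by omega) hj
  · -- the first neighbour after the interval, on the reversed path
    obtain ⟨c, _, hspan⟩ := exists_isSpan hw0
    have hcL := hspan.first_le.trans hspan.le
    have hc : k * (n + 1) + (n + 1) ≤ c := by
      by_contra! h
      rcases Nat.lt_or_ge c (k * (n + 1)) with h' | h'
      · exact hleft ⟨c, h', hspan.adj_first⟩
      · exact hgap c h' (by omega) hspan.adj_first
    refine false_of_gap hz.reverse hmax hF1 hF2 hw le_rfl hn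
      (fun i h1 h2 j hj => hne i h1 h2 _ (by omega)) (fun i h1 h2 j hj => hadj i h1 h2 _ (by omega))
      (c := L - c) (by omega) ?_ ?_
    · rw [Nat.sub_sub_self hcL]
      exact hspan.adj_first
    · intro j hj1 hj2 hj
      have := hspan.mem _ (by omega) hj
      omega

end Longest

/-! ### Paths along a longest induced path -/

section Inner

variable {V : Type u} {G : SimpleGraph V} {z : ℕ → V} {L m n s a : ℕ}

/-- The inner vertices of the path `z 0, …, z L` and the vertices attached to it. -/
def innerSet (G : SimpleGraph V) (z : ℕ → V) (L m : ℕ) : Set V :=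
  {x | (∃ i, m ≤ i ∧ i + m ≤ L ∧ x = z i) ∨ IsAttached G z L m x}

/-- The vertices attached to the path `z 0, …, z L` whose first neighbour on it is `z a`. -/
def gapSet (G : SimpleGraph V) (z : ℕ → V) (L m a : ℕ) : Set V :=
  {x | IsAttached G z L m x ∧ ∃ b, IsSpan G z L x a b}

theorem gapSet_bounds {x : V} (hx : x ∈ gapSet G z L m a) : m ≤ a ∧ a + m ≤ L := by
  obtain ⟨hx, b, hb⟩ := hx
  have := hx.isSpan_bounds hb
  have := hb.first_le
  omega

theorem gapSet_unique {x : V} {a' : ℕ} (hx : x ∈ gapSet G z L m a) (hx' : x ∈ gapSet G z L m a') :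
    a = a' := by
  obtain ⟨-, b, hb⟩ := hx
  obtain ⟨-, b', hb'⟩ := hx'
  have h1 := hb.mem a' (hb'.first_le.trans hb'.le) hb'.adj_first
  have h2 := hb'.mem a (hb.first_le.trans hb.le) hb.adj_first
  omega

/-- Outside of the inner vertices and the attached vertices, the independence number is bounded:
all these vertices are close to one of the two end segments of the path. -/
theorem indepBound_compl_innerSet (hG : G.Connected) (hz : IsIndPath G z L)
    (hmax : ∀ z' L', IsIndPath G z' L' → L' ≤ L) (hn : 1 ≤ n) (hm : n + 1 ≤ m)
    (hstar : ¬ (starK (s + 1)).IsIndContained G) (hkstar : ¬ (kStar (s + 1)).IsIndContained G)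
    (hF1 : ¬ (fGraph false false n).IsIndContained G)
    (hF2 : ¬ (fGraph true false n).IsIndContained G)
    (hL : (2 * s + 1) * (n + 1) ≤ L) :
    IndepBound G (innerSet G z L m)ᶜ ((nbhdBound s)^[n] (2 * m)) := by
  classical
  set E : Set V := {x | ∃ i ≤ L, (i < m ∨ L < i + m) ∧ x = z i} with hE
  have hEne : E.Nonempty := ⟨z 0, 0, by omega, by omega, rfl⟩
  have hEb : IndepBound G E (2 * m) := by
    intro I hI _
    have hsub : I ⊆ (Finset.range m).image z ∪ (Finset.range m).image fun i => z (L - i) := by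
      intro x hx
      obtain ⟨i, hi, h | h, rfl⟩ := hI hx
      · exact Finset.mem_union_left _ (Finset.mem_image_of_mem _ (Finset.mem_range.2 h))
      · refine Finset.mem_union_right _ (Finset.mem_image.2 ⟨L - i, ?_, ?_⟩)
        · rw [Finset.mem_range]
          omega
        · rw [Nat.sub_sub_self hi]
    have h1 := (Finset.card_le_card hsub).trans (Finset.card_union_le _ _)
    have h2 := Finset.card_image_le (s := Finset.range m) (f := z)
    have h3 := Finset.card_image_le (s := Finset.range m) (f := fun i => z (L - i))
    rw [Finset.card_range] at h2 h3
    omega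
  refine (hEb.setDist_le hG hEne hstar hkstar n).mono fun x hx => ?_
  change setDist G E x ≤ n
  have hS : (z '' Set.Iic L).Nonempty := ⟨z 0, 0, by simp, rfl⟩
  have hxn := setDist_le_of_longest hG hz hmax hn hstar hF1 hF2 hL x
  obtain ⟨w, hw, hwd, hwa⟩ := exists_chain_setDist hG hS _ x rfl
  set k := setDist G (z '' Set.Iic L) x with hk
  rcases Nat.eq_zero_or_pos k with h0 | hpos
  · obtain ⟨i, hi, rfl⟩ := (setDist_eq_zero hG hS).1 h0
    have hmem : z i ∈ E := by
      by_contra hno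
      refine hx (Or.inl ⟨i, ?_, ?_, rfl⟩)
      · by_contra h
        exact hno ⟨i, hi, by omega, rfl⟩
      · by_contra h
        exact hno ⟨i, hi, by omega, rfl⟩
    rw [(setDist_eq_zero hG hEne).2 hmem]
    exact Nat.zero_le _
  have hoff : ∀ i, 1 ≤ i → i ≤ k → ∀ j ≤ L, w i ≠ z j := by
    intro i h1 h2 j hj h
    have := hwd i h2
    rw [(setDist_eq_zero hG hS).2 ⟨j, hj, h.symm⟩] at this
    omega
  obtain ⟨i₀, hi₀, hw0⟩ := (setDist_eq_zero hG hS).1 (hwd 0 (by omega))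
  by_cases hatt : IsAttached G z L m (w 1)
  · exfalso
    rcases Nat.lt_or_eq_of_le hpos with h2 | h1
    · refine hatt.no_pendant hz hm hF1 hF2 (hwa 1 h2) (hoff 2 (by omega) h2) fun j hj h => ?_
      have h3 := setDist_le_of_adj hG hS h
      rw [hwd 2 h2, (setDist_eq_zero hG hS).2 ⟨j, hj, rfl⟩] at h3
      omega
    · exact hx (Or.inr (by rwa [← hw, ← h1]))
  · obtain ⟨i, hi, hadj, hend⟩ : ∃ i ≤ L, G.Adj (w 1) (z i) ∧ (i < m ∨ L < i + m) := by
      by_contra! hno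
      exact hatt ⟨hoff 1 le_rfl hpos, ⟨i₀, hi₀, hw0 ▸ (hwa 0 hpos).symm⟩, hno⟩
    have hdist : ∀ j, 1 ≤ j → j ≤ k → setDist G E (w j) ≤ j := by
      intro j hj
      induction j, hj using Nat.le_induction with
      | base =>
        intro _
        have := setDist_le_of_adj hG hEne hadj
        rwa [(setDist_eq_zero hG hEne).2 ⟨i, hi, hend, rfl⟩] at this
      | succ j hj ih =>
        intro hjk
        have := setDist_le_of_adj hG hEne (hwa j (by omega)).symm
        have := ih (by omega)
        omega
    have := hdist k hpos le_rfl
    rw [hw] at this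
    omega

/-- Consecutive disjoint paths can be concatenated to a path. -/
theorem isListPath_flatMap {N : ℕ} (hN : 0 < N) (f : ℕ → List V)
    (hf : ∀ i < N, IsListPath G (f i))
    (hlink : ∀ i, i + 1 < N → ∀ x ∈ (f i).getLast?, ∀ y ∈ (f (i + 1)).head?, G.Adj x y)
    (hdisj : ∀ i j, i < j → j < N → List.Disjoint (f i) (f j)) :
    IsListPath G ((List.range N).flatMap f) := by
  refine ⟨?_, ?_, ?_⟩
  · intro h
    rw [List.flatMap_eq_nil_iff] at h
    exact (hf 0 hN).ne_nil (h 0 (List.mem_range.2 hN))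
  · rw [List.flatMap_def, List.isChain_flatten]
    · refine ⟨?_, ?_⟩
      · intro l hl
        obtain ⟨i, hi, rfl⟩ := List.mem_map.1 hl
        exact (hf i (List.mem_range.1 hi)).chain
      · rw [List.isChain_iff_getElem]
        intro i hi
        simp only [List.length_map, List.length_range] at hi
        simpa using hlink i hi
    · intro h
      obtain ⟨i, hi, hnil⟩ := List.mem_map.1 h
      exact (hf i (List.mem_range.1 hi)).ne_nil hnil
  · rw [List.nodup_flatMap]
    refine ⟨fun i hi => (hf i (List.mem_range.1 hi)).nodup, ?_⟩
    rw [List.pairwise_iff_getElem]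
    intro i j hi hj hij
    simp only [List.length_range] at hi hj
    simpa using hdisj i j hij hj

/-- If `F^{(3)}` and `F^{(4)}` are forbidden too, the inner and the attached vertices form a single
path: the attached vertices with first neighbour `z a` form a clique and are inserted between `z a`
and `z (a + 1)`. -/
theorem hasPartition_innerSet [Finite V] (hz : IsIndPath G z L) (hm : n + 1 ≤ m) (hL : 2 * m ≤ L)
    (hF1 : ¬ (fGraph false false n).IsIndContained G)
    (hF3 : ¬ (fGraph false true n).IsIndContained G)
    (hF4 : ¬ (fGraph true true n).IsIndContained G) :
    HasPartition G (innerSet G z L m) 1 := by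
  classical
  have := Fintype.ofFinite V
  set f : ℕ → List V := fun j => z (m + j) :: (gapSet G z L m (m + j)).toFinset.toList with hf
  have hmem : ∀ j x, x ∈ f j ↔ x = z (m + j) ∨ x ∈ gapSet G z L m (m + j) := by
    intro j x
    simp [hf]
  have hoff : ∀ a x, x ∈ gapSet G z L m a → ∀ i ≤ L, x ≠ z i := fun a x hx => hx.1.ne
  have hnext : ∀ j, m + j < L → ∀ x ∈ f j, G.Adj x (z (m + j + 1)) := by
    intro j hj x hx
    rcases (hmem j x).1 hx with rfl | ⟨hx, b, hb⟩
    · exact (hz.adj _ (by omega) _ (by omega)).2 (by omega)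
    · exact (hx.adj_succ_or hz hm hF1 hb).resolve_right fun h => hF3 h.2
  have hpath : IsListPath G ((List.range (L - 2 * m + 1)).flatMap f) := by
    refine isListPath_flatMap (by omega) f ?_ ?_ ?_
    · intro j hj
      refine ⟨by simp [hf], ?_, ?_⟩
      · refine List.Pairwise.isChain ?_
        refine List.pairwise_cons.2 ⟨?_, ?_⟩
        · intro x hx
          obtain ⟨-, b, hb⟩ : x ∈ gapSet G z L m (m + j) := by simpa using hx
          exact hb.adj_first.symm
        · refine (Finset.nodup_toList _).imp_of_mem ?_
          intro x y hx hy hxy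
          obtain ⟨hx, b, hb⟩ : x ∈ gapSet G z L m (m + j) := by simpa using hx
          obtain ⟨hy, b', hb'⟩ : y ∈ gapSet G z L m (m + j) := by simpa using hy
          exact hx.adj_of_first_eq hz hm hF1 hF3 hF4 hy hb hb' hxy
      · refine List.nodup_cons.2 ⟨fun h => ?_, Finset.nodup_toList _⟩
        have h' : z (m + j) ∈ gapSet G z L m (m + j) := by simpa using h
        exact hoff _ _ h' (m + j) (by omega) rfl
    · intro j hj x hx y hy
      obtain rfl : z (m + (j + 1)) = y := by simpa [hf] using hy
      exact hnext j (by omega) x (List.mem_of_getLast? hx)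
    · intro i j hij hj x hx hx'
      rcases (hmem i x).1 hx with rfl | hx <;> rcases (hmem j _).1 hx' with hx' | hx'
      · have := hz.inj _ (by omega) _ (by omega) hx'
        omega
      · exact hoff _ _ hx' _ (by omega) rfl
      · exact hoff _ _ hx _ (by omega) hx'
      · have := gapSet_unique hx hx'
        omega
  refine ⟨[(List.range (L - 2 * m + 1)).flatMap f], by simp, by simpa using hpath,
    by simpa using hpath.nodup, fun x => ?_⟩
  rw [List.flatten_singleton, List.mem_flatMap]
  constructor
  · rintro ⟨j, hj, hx⟩
    rw [List.mem_range] at hj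
    rcases (hmem j x).1 hx with rfl | hx
    · exact Or.inl ⟨m + j, by omega, by omega, rfl⟩
    · exact Or.inr hx.1
  · rintro (⟨i, h1, h2, rfl⟩ | hx)
    · refine ⟨i - m, List.mem_range.2 (by omega), (hmem _ _).2 (Or.inl ?_)⟩
      rw [Nat.add_sub_cancel' h1]
    · obtain ⟨a, b, hb⟩ := exists_isSpan hx.exists_adj
      have hbd := gapSet_bounds (a := a) ⟨hx, b, hb⟩
      refine ⟨a - m, List.mem_range.2 (by omega), (hmem _ _).2 (Or.inr ?_)⟩
      rw [Nat.add_sub_cancel' hbd.1]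
      exact ⟨hx, b, hb⟩

/-- A path through `z a`, a given path `R` of attached vertices with first neighbour `z a`, and
possibly `z (a + 1)`, which can be continued by `z (a + 2)`. -/
theorem exists_block (hz : IsIndPath G z L) (hm : n + 1 ≤ m)
    (hF1 : ¬ (fGraph false false n).IsIndContained G) (ha : a + 2 ≤ L) {R : List V}
    (hR : R.IsChain G.Adj) (hRn : R.Nodup) (hRmem : ∀ x ∈ R, x ∈ gapSet G z L m a) :
    ∃ l, IsListPath G l ∧ l.head? = some (z a) ∧
      (∀ x ∈ l, x = z a ∨ x = z (a + 1) ∨ x ∈ gapSet G z L m a) ∧ (∀ x ∈ R, x ∈ l) ∧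
      ∀ x ∈ l.getLast?, G.Adj x (z (a + 2)) := by
  have hpath : IsListPath G (z a :: R) := by
    refine ⟨by simp, ?_, List.nodup_cons.2 ⟨fun h => (hRmem _ h).1.ne a (by omega) rfl, hRn⟩⟩
    rw [List.isChain_cons]
    refine ⟨fun y hy => ?_, hR⟩
    obtain ⟨-, b, hb⟩ := hRmem y (List.mem_of_head? hy)
    exact hb.adj_first.symm
  have hlast : (z a :: R).getLast? = some ((z a :: R).getLast (by simp)) :=
    List.getLast?_eq_some_getLast _
  set x := (z a :: R).getLast (by simp) with hx
  have hxmem : x ∈ z a :: R := List.getLast_mem _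
  by_cases hadj : G.Adj x (z (a + 1))
  · refine ⟨(z a :: R) ++ [z (a + 1)], ⟨by simp, ?_, ?_⟩, by simp, ?_, ?_, ?_⟩
    · rw [List.isChain_append]
      refine ⟨hpath.chain, by simp, ?_⟩
      rw [hlast]
      simpa using hadj
    · refine hpath.nodup.append (by simp) ?_
      intro y hy hy'
      obtain rfl : y = z (a + 1) := by simpa using hy'
      rcases List.mem_cons.1 hy with h | h
      · have := hz.inj _ (by omega) _ (by omega) h
        omega
      · exact (hRmem _ h).1.ne _ (by omega) rfl
    · intro y hy
      simp only [List.cons_append, List.mem_cons, List.mem_append, List.not_mem_nil, or_false] at hy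
      rcases hy with h | h | h
      · exact Or.inl h
      · exact Or.inr (Or.inr (hRmem y h))
      · exact Or.inr (Or.inl h)
    · intro y hy
      simp [hy]
    · intro y hy
      obtain rfl : z (a + 1) = y := by
        rw [List.getLast?_append] at hy
        simpa using hy
      exact (hz.adj _ (by omega) _ (by omega)).2 (by omega)
  · refine ⟨z a :: R, hpath, rfl, ?_, fun y hy => List.mem_cons_of_mem _ hy, ?_⟩
    · intro y hy
      rcases List.mem_cons.1 hy with h | h
      · exact Or.inl h
      · exact Or.inr (Or.inr (hRmem y h))
    · intro y hy
      rw [hlast] at hy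
      obtain rfl : x = y := by simpa using hy
      rcases List.mem_cons.1 hxmem with h | h
      · exact absurd ((hz.adj _ (by omega) _ (by omega)).2 (by omega)) (h ▸ hadj)
      · obtain ⟨hatt, b, hb⟩ := hRmem _ h
        exact ((hatt.adj_succ_or hz hm hF1 hb).resolve_left hadj).1

theorem HasCover.biUnion {S : ℕ → Set V} {k : ℕ} (N : ℕ) (h : ∀ i < N, HasCover G (S i) k) :
    HasCover G {x | ∃ i < N, x ∈ S i} (N * k) := by
  induction N with
  | zero => exact ⟨[], by simp, by simp, by simp⟩
  | succ N ih =>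
    obtain ⟨Q, h1, h2, h3⟩ := (ih fun i hi => h i (by omega)).union (h N (by omega))
    refine ⟨Q, by rw [add_mul, one_mul]; exact h1, h2, ?_⟩
    rintro x ⟨i, hi, hx⟩
    refine h3 x ?_
    rcases (Nat.lt_succ_iff.1 hi).lt_or_eq with h | rfl
    · exact Or.inl ⟨i, h, hx⟩
    · exact Or.inr hx

/-- The inner and the attached vertices are covered by a bounded number of paths. The attached
vertices with first neighbour `z a` split into at most `s` paths; for every parity and every index
`k`, one path collects the `k`-th of these paths for all `a` of this parity. -/
theorem hasCover_innerSet [Finite V] (hz : IsIndPath G z L) (hm : n + 3 ≤ m) (hL : 2 * m ≤ L)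
    (hstar : ¬ (starK (s + 1)).IsIndContained G)
    (hF1 : ¬ (fGraph false false n).IsIndContained G) :
    HasCover G (innerSet G z L m) (2 * ((s + 1) * 1)) := by
  have hpart : ∀ a, ∃ Q : List (List V), Q.length ≤ s ∧ (∀ l ∈ Q, IsListPath G l) ∧
      ∀ x, x ∈ Q.flatten ↔ x ∈ gapSet G z L m a := by
    intro a
    have hb : IndepBound G (gapSet G z L m a) s :=
      (indepBound_neighborSet hstar (z a)).mono fun x hx => by
        obtain ⟨-, b, hb⟩ := hx
        exact hb.adj_first.symm
    obtain ⟨Q, h1, h2, -, h3⟩ := hb.hasPartition (Set.toFinite _)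
    exact ⟨Q, h1, h2, h3⟩
  choose Q hQlen hQpath hQmem using hpart
  set R : ℕ → ℕ → List V := fun a k => (Q a)[k]?.getD [] with hRdef
  have hblock : ∀ a k, a + 2 ≤ L → ∃ l, IsListPath G l ∧ l.head? = some (z a) ∧
      (∀ x ∈ l, x = z a ∨ x = z (a + 1) ∨ x ∈ gapSet G z L m a) ∧
      (∀ x ∈ R a k, x ∈ l) ∧ ∀ x ∈ l.getLast?, G.Adj x (z (a + 2)) := by
    intro a k ha
    have hR : R a k = [] ∨ R a k ∈ Q a := by
      rw [hRdef]
      rcases h : (Q a)[k]? with _ | l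
      · exact Or.inl (by simp [h])
      · exact Or.inr (by simpa [h] using List.mem_of_getElem? h)
    refine exists_block hz (by omega) hF1 ha ?_ ?_ ?_
    · rcases hR with h | h
      · rw [h]; exact List.isChain_nil
      · exact (hQpath a _ h).chain
    · rcases hR with h | h
      · rw [h]; exact List.nodup_nil
      · exact (hQpath a _ h).nodup
    · intro x hx
      rcases hR with h | h
      · rw [h] at hx; simp at hx
      · exact (hQmem a x).1 (List.mem_flatten.2 ⟨_, h, hx⟩)
  choose! B hBpath hBhead hBmem hBR hBlast using hblock
  have hone : ∀ p < 2, ∀ k < s + 1, HasCover G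
      {x | ∃ j < (L - 2 * m) / 2 + 1, x ∈ B (m + p + 2 * j) k} 1 := by
    intro p hp k _
    have hb : ∀ j < (L - 2 * m) / 2 + 1, m + p + 2 * j + 2 ≤ L := fun j hj => by omega
    refine ⟨[(List.range ((L - 2 * m) / 2 + 1)).flatMap fun j => B (m + p + 2 * j) k], by simp,
      ?_, ?_⟩
    · simp only [List.mem_singleton, forall_eq]
      refine isListPath_flatMap (by omega) _ (fun j hj => hBpath _ _ (hb j hj)) ?_ ?_
      · intro j hj x hx y hy
        rw [hBhead _ _ (hb _ hj)] at hy
        obtain rfl : z (m + p + 2 * (j + 1)) = y := by simpa using hy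
        exact hBlast _ _ (hb j (by omega)) x hx
      · intro i j hij hj x hx hx'
        have h1 := hb i (by omega)
        have h2 := hb j hj
        have hinj : ∀ t ≤ L, ∀ t' ≤ L, z t = z t' → t = t' := hz.inj
        rcases hBmem _ _ h1 x hx with h | h | h <;> rcases hBmem _ _ h2 x hx' with h' | h' | h'
        · have := hinj _ (by omega) _ (by omega) (h.symm.trans h'); omega
        · have := hinj _ (by omega) _ (by omega) (h.symm.trans h'); omega
        · exact h'.1.ne _ (by omega) h
        · have := hinj _ (by omega) _ (by omega) (h.symm.trans h'); omega
        · have := hinj _ (by omega) _ (by omega) (h.symm.trans h'); omega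
        · exact h'.1.ne _ (by omega) h
        · exact h.1.ne _ (by omega) h'
        · exact h.1.ne _ (by omega) h'
        · have := gapSet_unique h h'; omega
    · rintro x ⟨j, hj, hx⟩
      rw [List.flatten_singleton, List.mem_flatMap]
      exact ⟨j, List.mem_range.2 hj, hx⟩
  obtain ⟨Q', h1, h2, h3⟩ := HasCover.biUnion 2 fun p hp => HasCover.biUnion (s + 1) (hone p hp)
  refine ⟨Q', h1, h2, fun x hx => h3 x ?_⟩
  -- `i = m + p + 2 j` with `p` the parity of `i - m`
  have hidx : ∀ i, m ≤ i → i + m ≤ L → (i - m) % 2 < 2 ∧ (i - m) / 2 < (L - 2 * m) / 2 + 1 ∧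
      m + (i - m) % 2 + 2 * ((i - m) / 2) = i := fun i _ _ => by omega
  rcases hx with ⟨i, hi1, hi2, rfl⟩ | hx
  · obtain ⟨hp, hj, hi⟩ := hidx i hi1 hi2
    refine ⟨_, hp, 0, by omega, _, hj, ?_⟩
    rw [hi]
    exact List.mem_of_head? (hBhead i 0 (by omega))
  · obtain ⟨a, b, hb⟩ := exists_isSpan hx.exists_adj
    have hgap : x ∈ gapSet G z L m a := ⟨hx, b, hb⟩
    have hbd := gapSet_bounds hgap
    obtain ⟨hp, hj, hi⟩ := hidx a hbd.1 hbd.2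
    obtain ⟨l, hl, hxl⟩ := List.mem_flatten.1 ((hQmem a x).2 hgap)
    obtain ⟨k, hk, rfl⟩ := List.getElem_of_mem hl
    have := hQlen a
    refine ⟨_, hp, k, by omega, _, hj, ?_⟩
    rw [hi]
    refine hBR a k (by omega) x ?_
    rw [hRdef]
    simpa [List.getElem?_eq_getElem hk] using hxl

theorem exists_longest_isIndPath [Finite V] [Nonempty V] (G : SimpleGraph V) :
    ∃ z L, IsIndPath G z L ∧ ∀ z' L', IsIndPath G z' L' → L' ≤ L := by
  classical
  have := Fintype.ofFinite V
  have h0 : ∃ z, IsIndPath G z 0 := ⟨fun _ => Classical.arbitrary V, fun i hi j hj _ => by omega,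
    fun i hi j hj => iff_of_false (by simp) (by omega)⟩
  obtain ⟨z, hz⟩ := Nat.findGreatest_spec (P := fun L => ∃ z, IsIndPath G z L)
    (Nat.zero_le (Fintype.card V)) h0
  exact ⟨z, _, hz, fun z' L' h => Nat.le_findGreatest h.lt_card.le ⟨z', h⟩⟩

/-- The bound for the independence number of a graph without long induced paths. -/
def smallBound (s n : ℕ) : ℕ := (nbhdBound s)^[(2 * s + 1) * (n + 1) + 2 * (n + 3)] 1

/-- The bound for the independence number of the vertices that are neither inner vertices of a
longest induced path nor attached to it. -/
def outerBound (s n : ℕ) : ℕ := (nbhdBound s)^[n] (2 * (n + 3))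

/-- The dichotomy behind both bounds: either the independence number is bounded, or there is a long
induced path such that the vertices which are neither on its inner part nor attached to it have
bounded independence number. -/
theorem indepBound_or_innerSet [Finite V] (hG : G.Connected) (hn : 1 ≤ n)
    (hstar : ¬ (starK (s + 1)).IsIndContained G) (hkstar : ¬ (kStar (s + 1)).IsIndContained G)
    (hF1 : ¬ (fGraph false false n).IsIndContained G)
    (hF2 : ¬ (fGraph true false n).IsIndContained G) :
    IndepBound G Set.univ (smallBound s n) ∨
      ∃ z L, IsIndPath G z L ∧ 2 * (n + 3) ≤ L ∧
        IndepBound G (innerSet G z L (n + 3))ᶜ (outerBound s n) := by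
  obtain ⟨x₀⟩ := hG.nonempty
  have : Nonempty V := ⟨x₀⟩
  obtain ⟨z, L, hz, hmax⟩ := exists_longest_isIndPath G
  rcases Nat.lt_or_ge L ((2 * s + 1) * (n + 1) + 2 * (n + 3)) with hL | hL
  · left
    have h1 : IndepBound G {x₀} 1 := fun I hI _ => by
      simpa using Finset.card_le_card (show I ⊆ {x₀} from fun x hx => by simpa using hI hx)
    refine (h1.setDist_le hG (Set.singleton_nonempty x₀) hstar hkstar _).mono fun x _ => ?_
    obtain ⟨w, -, hwd, hwa⟩ := exists_chain_setDist hG (Set.singleton_nonempty x₀) _ x rfl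
    have := hmax _ _ (isIndPath_of_setDist (o := 0) hG (Set.singleton_nonempty x₀) hwd hwa le_rfl)
    exact (this.trans_lt hL).le
  · exact Or.inr ⟨z, L, hz, by omega, indepBound_compl_innerSet hG hz hmax hn (by omega) hstar
      hkstar hF1 hF2 (by omega)⟩

end Inner

/-! ### The characterizations -/

section Characterization

theorem exists_pathCoverNumber_le (n : ℕ) (hn : 2 ≤ n) :
    ∃ c : ℕ, ∀ {V : Type v} [Finite V] (G : SimpleGraph V), G.Connected →
      ¬ (starK n).IsIndContained G → ¬ (kStar n).IsIndContained G →
      ¬ (graphF1 n n).IsIndContained G → ¬ (graphF2 n n).IsIndContained G →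
      pathCoverNumber G ≤ c := by
  obtain ⟨s, rfl⟩ : ∃ s, n = s + 1 := ⟨n - 1, by omega⟩
  refine ⟨max (smallBound s (s + 1)) (2 * ((s + 1) * 1) + outerBound s (s + 1)),
    fun {V} _ G hG hstar hkstar hF1 hF2 => HasCover.pathCoverNumber_le ?_⟩
  rcases indepBound_or_innerSet hG (by omega) hstar hkstar hF1 hF2 with h | ⟨z, L, hz, hL, h⟩
  · exact (h.hasPartition Set.finite_univ).hasCover.mono (le_max_left _ _)
  · rw [← Set.union_compl_self]
    exact ((hasCover_innerSet hz le_rfl hL hstar hF1).union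
      (h.hasPartition (Set.toFinite _)).hasCover).mono (le_max_right _ _)

theorem exists_pathPartitionNumber_le (n : ℕ) (hn : 2 ≤ n) :
    ∃ c : ℕ, ∀ {V : Type v} [Finite V] (G : SimpleGraph V), G.Connected →
      ¬ (starK n).IsIndContained G → ¬ (kStar n).IsIndContained G →
      ¬ (graphF1 n n).IsIndContained G → ¬ (graphF2 n n).IsIndContained G →
      ¬ (graphF3 n n).IsIndContained G → ¬ (graphF4 n n).IsIndContained G →
      pathPartitionNumber G ≤ c := by
  obtain ⟨s, rfl⟩ : ∃ s, n = s + 1 := ⟨n - 1, by omega⟩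
  refine ⟨max (smallBound s (s + 1)) (1 + outerBound s (s + 1)),
    fun {V} _ G hG hstar hkstar hF1 hF2 hF3 hF4 =>
    HasPartition.pathPartitionNumber_le ?_⟩
  rcases indepBound_or_innerSet hG (by omega) hstar hkstar hF1 hF2 with h | ⟨z, L, hz, hL, h⟩
  · exact (h.hasPartition Set.finite_univ).mono (le_max_left _ _)
  · rw [← Set.union_compl_self]
    exact ((hasPartition_innerSet hz (by omega) hL hF1 hF3 hF4).union
      (h.hasPartition (Set.toFinite _)) disjoint_compl_right).mono (le_max_right _ _)

theorem IsFreeOf.of_familyLE {ℋ₁ ℋ₂ : Set FinGraph} {G : FinGraph} (h : IsFreeOf ℋ₁ G)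
    (hle : FamilyLE ℋ₁ ℋ₂) : IsFreeOf ℋ₂ G := by
  intro H₂ hH₂ hc
  obtain ⟨H₁, hH₁, h'⟩ := hle H₂ hH₂
  exact h H₁ hH₁ (h'.trans hc)

theorem mainTheorem1 (ℋ : Set FinGraph.{u}) (hfin : ℋ.Finite)
    (hconn : ∀ H ∈ ℋ, H.graph.Connected) :
    (PathCoverBounded.{u, v} ℋ ↔
      ∃ n : ℕ, 2 ≤ n ∧ FamilyLE ℋ
        {(starK n).toFinGraph, (kStar n).toFinGraph,
          (graphF1 n n).toFinGraph, (graphF2 n n).toFinGraph}) ∧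
    (PathPartitionBounded.{u, v} ℋ ↔
      ∃ n : ℕ, 2 ≤ n ∧ FamilyLE ℋ
        {(starK n).toFinGraph, (kStar n).toFinGraph,
          (graphF1 n n).toFinGraph, (graphF2 n n).toFinGraph,
          (graphF3 n n).toFinGraph, (graphF4 n n).toFinGraph}) := by
  refine ⟨⟨fun h => ?_, ?_⟩, ⟨fun h => ?_, ?_⟩⟩
  · obtain ⟨n, h1, h2, h3, h4, hn⟩ := ((eventually_starK h).and ((eventually_kStar h).and
      ((eventually_fGraph_pendant hfin hconn h false).and
      ((eventually_fGraph_pendant hfin hconn h true).and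
      (Filter.eventually_ge_atTop 2))))).exists
    refine ⟨n, hn, ?_⟩
    rintro H₂ (rfl | rfl | rfl | rfl)
    exacts [h1, h2, h3, h4]
  · rintro ⟨n, hn, hle⟩
    obtain ⟨c, hc⟩ := exists_pathCoverNumber_le.{v} n hn
    refine ⟨c, fun G hG hfree => ?_⟩
    have h := hfree.of_familyLE hle
    exact hc G.graph hG (h (starK n).toFinGraph (by simp)) (h (kStar n).toFinGraph (by simp))
      (h (graphF1 n n).toFinGraph (by simp)) (h (graphF2 n n).toFinGraph (by simp))
  · have h' := h.pathCoverBounded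
    obtain ⟨n, h1, h2, h3, h4, h5, h6, hn⟩ := ((eventually_starK h').and ((eventually_kStar h').and
      ((eventually_fGraph_pendant hfin hconn h' false).and
      ((eventually_fGraph_pendant hfin hconn h' true).and
      ((eventually_fGraph_twin hfin hconn h false).and
      ((eventually_fGraph_twin hfin hconn h true).and
      (Filter.eventually_ge_atTop 2))))))).exists
    refine ⟨n, hn, ?_⟩
    rintro H₂ (rfl | rfl | rfl | rfl | rfl | rfl)
    exacts [h1, h2, h3, h4, h5, h6]
  · rintro ⟨n, hn, hle⟩
    obtain ⟨c, hc⟩ := exists_pathPartitionNumber_le.{v} n hn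
    refine ⟨c, fun G hG hfree => ?_⟩
    have h := hfree.of_familyLE hle
    exact hc G.graph hG (h (starK n).toFinGraph (by simp)) (h (kStar n).toFinGraph (by simp))
      (h (graphF1 n n).toFinGraph (by simp)) (h (graphF2 n n).toFinGraph (by simp))
      (h (graphF3 n n).toFinGraph (by simp)) (h (graphF4 n n).toFinGraph (by simp))

end Characterization
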